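/- **Setting.** Let $(M,g)$ be a smooth pseudo-Riemannian manifold of dimension $n$ and signature $\varepsilon=(\varepsilon_1,\dots,\varepsilon_n)\in\{\pm1\}^n$ with a spin structure, i.e. a lift of the orthonormal frames of $M$ to a principal bundle for the group $\mathrm{Spin}$ of those products $h$ of an even number of invertible vectors in the Clifford algebra (with $vw+wv=-2g(v,w)$) for which $h^{-1}$ is the reversed product. Let $S$ be the associated spinor bundle over $\mathbb K=\mathbb C$ (or $\mathbb K=\mathbb R$ in the case of real spinors), of rank $2^{\lfloor n/2\rfloor}$, with Clifford multiplication $\gamma(X)\xi=X\xi$, $XY+YX=-2g(X,Y)$. Let $\nabla$ be the Levi-Civita connection on $M$ and on $S$. Let $C$ be a charge conjugation on $S$: the parallel nondegenerate bilinear form induced by a form on the spinor module with $C(\varphi,\psi)=\Delta_0\,C(\psi,\varphi)$ and $C(\varphi,X\psi)=\Delta_1\,C(\psi,X\varphi)$, where $\Delta_0,\Delta_1\in\{\pm1\}$. For $k\in\mathbb Z$ put $\Delta_k=(-1)^{k(k-1)/2}\Delta_0^{k+1}\Delta_1^k$. An endomorphism $\Phi$ of $S$ has the charge adjoint $\Phi^C$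 given by $C(\Phi^C\eta,\xi)=C(\eta,\Phi\xi)$. Let $D=\nabla+\mathcal A$ be a connection on $S$, where $\mathcal A$ is a one-form with values in the $\mathbb K$-linear endomorphisms of $S$, and put $D^C=\nabla-\mathcal A^C$ and $$(\hat D_Z\gamma)(X)\xi=D_Z(X\xi)-(\nabla_ZX)\xi-X\,D^C_Z\xi .$$ The connection $D$ is called *admissible* if $\hat D\gamma$ is skew symmetric, i.e. $(\hat D_Z\gamma)(X)=-(\hat D_X\gamma)(Z)$ for all vector fields $X,Z$. A $\mathbb K$-valued $\ell$-form $\omega$ acts on $S$ by $\frac1{\ell!}\,\omega_{\mu_1\dots\mu_\ell}\gamma^{\mu_1}\cdots\gamma^{\mu_\ell}$; vectors and one-forms are identified by $g$. Let $\Omega^{(\ell,1)}$ be the space of those $\mathcal A_0\in\Omega^1\otimes\Omega^\ell$ whose total skew symmetrization and whose metric trace $\sum_a\varepsilon_a\,e_a\rfloor\mathcal A_0(e_a)$ vanish ($e$ an orthonormal frame with $g(e_a,e_b)=\varepsilon_a\delta_{ab}$). Forms are sections without any regularity assumption, and there are no nonzero forms of degree $-1$. **Theorem.** Suppose that $\mathcal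 A$ is homogeneous of degree $\ell$, $0\le\ell\le n$: every $\mathcal A_X$ is given by the action of an $\ell$-form. Then there are a unique $(\ell+1)$-form $F$, a unique $(\ell-1)$-form $G$ and a unique $\mathcal A_0\in\Omega^{(\ell,1)}$ such that, for all $X$, the endomorphism $\mathcal A_X$ is given by the $\ell$-form $$X\rfloor F+X\wedge G+\mathcal A_0(X).$$ The connection $D$ is admissible if and only if $\mathcal A_0=0$ and $\Delta_1\Delta_{\deg}=-1$ for the degree $\deg$ of each nonzero form among $F$ and $G$, that is: $$\mathcal A_0=0,\qquad F\neq0\Rightarrow\Delta_1\Delta_{\ell+1}=-1,\qquad G\neq0\Rightarrow\Delta_1\Delta_{\ell-1}=-1 .$$ Moreover, for every integer $\deg$, the following are equivalent: $\Delta_1\Delta_{\deg}=-1$; $\ \Delta_0\Delta_{\deg-1}=(-1)^{\deg}$; $\ \deg\equiv3$ or $\deg\equiv1+\Delta_0\Delta_1\pmod 4$. -/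

import Mathlib

open scoped Manifold ContDiff Bundle

noncomputable section

namespace SpinGeometry

/-! ### Signs and the model Clifford algebra -/

/-- The sign `Δ_k = (-1)^{k(k-1)/2} Δ₀^{k+1} Δ₁^k` of the bilinear map
`φ ⊗ ψ ↦ C(φ, γ_{μ₁…μ_k} ψ)`, for a charge conjugation `C` with `C(φ, ψ) = Δ₀ C(ψ, φ)` and
`C(φ, X ψ) = Δ₁ C(ψ, X φ)`. -/
def Delta (Δ₀ Δ₁ : ℤˣ) (k : ℤ) : ℤˣ := (-1) ^ (k * (k - 1) / 2) * Δ₀ ^ (k + 1) * Δ₁ ^ k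

/-- A sign as a real number. -/
def sgn (s : ℤˣ) : ℝ := ((s : ℤ) : ℝ)

/-- The standard scalar product `∑ ε_a v_a w_a` on `ℝⁿ` of signature `ε`. -/
def modelInner {n : ℕ} (ε : Fin n → ℤˣ) (v w : Fin n → ℝ) : ℝ := ∑ a, sgn (ε a) * v a * w a

/-- The quadratic form `v ↦ -∑ ε_a v_a²`.  Its Clifford algebra has the relations
`v w + w v = -2 ⟨v, w⟩`. -/
def cliffordForm {n : ℕ} (ε : Fin n → ℤˣ) : QuadraticForm ℝ (Fin n → ℝ) :=
  QuadraticMap.weightedSumSquares ℝ (fun a => -sgn (ε a))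

/-- A spinor module: a module `F` over `𝕜` (`= ℝ` or `ℂ`) for the Clifford algebra of the standard
scalar product of signature `ε` on `ℝⁿ`, of dimension `2^⌊n/2⌋`.  For `𝕜 = ℂ` these are the
irreducible complex modules (Dirac spinors), for `𝕜 = ℝ` these are the real forms of them. -/
structure SpinorModule (𝕜 : Type*) [RCLike 𝕜] (F : Type*) [NormedAddCommGroup F] [NormedSpace ℝ F]
    [NormedSpace 𝕜 F] [IsScalarTower ℝ 𝕜 F] {n : ℕ} (ε : Fin n → ℤˣ) where
  act : CliffordAlgebra (cliffordForm ε) →ₐ[ℝ] Module.End 𝕜 F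
  finrank_eq : Module.finrank 𝕜 F = 2 ^ (n / 2)

/-- A charge conjugation on a spinor module: a nondegenerate bilinear form, which is symmetric or
skew symmetric (`Δ₀ = ± 1`), and for which the same holds for `(φ, ψ) ↦ C(φ, v ψ)` (`Δ₁ = ± 1`). -/
structure ChargeConjugation {𝕜 : Type*} [RCLike 𝕜] {F : Type*} [NormedAddCommGroup F]
    [NormedSpace ℝ F] [NormedSpace 𝕜 F] [IsScalarTower ℝ 𝕜 F] {n : ℕ} {ε : Fin n → ℤˣ}
    (ρ : SpinorModule 𝕜 F ε) where
  form : LinearMap.BilinForm 𝕜 F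
  nondegenerate : form.Nondegenerate
  Δ₀ : ℤˣ
  Δ₁ : ℤˣ
  symm_zero : ∀ φ ψ : F, form φ ψ = (Δ₀ : ℤ) • form ψ φ
  symm_one : ∀ (v : Fin n → ℝ) (φ ψ : F),
    form φ (ρ.act (CliffordAlgebra.ι _ v) ψ) = (Δ₁ : ℤ) • form ψ (ρ.act (CliffordAlgebra.ι _ v) φ)

namespace ChargeConjugation

variable {𝕜 : Type*} [RCLike 𝕜] {F : Type*} [NormedAddCommGroup F]
    [NormedSpace ℝ F] [NormedSpace 𝕜 F] [IsScalarTower ℝ 𝕜 F] {n : ℕ} {ε : Fin n → ℤˣ}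
    {ρ : SpinorModule 𝕜 F ε} (C : ChargeConjugation ρ)

/-- The sign `Δ_k` of a charge conjugation. -/
def Δ (k : ℤ) : ℤˣ := Delta C.Δ₀ C.Δ₁ k

/-- Clifford multiplication by vectors is symmetric or skew symmetric for `C`. -/
theorem form_act_ι (v : Fin n → ℝ) (φ ψ : F) :
    C.form (ρ.act (CliffordAlgebra.ι _ v) φ) ψ =
      ((C.Δ₀ * C.Δ₁ : ℤˣ) : ℤ) • C.form φ (ρ.act (CliffordAlgebra.ι _ v) ψ) := by
  rw [C.symm_zero, C.symm_one v ψ φ, smul_smul]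
  simp

/-- The adjoint of the action of an even element. -/
theorem form_act_even (a : CliffordAlgebra (cliffordForm ε))
    (ha : a ∈ CliffordAlgebra.even (cliffordForm ε)) :
    ∀ φ ψ : F, C.form (ρ.act a φ) ψ = C.form φ (ρ.act (star a) ψ) := by
  have hs : ((C.Δ₀ * C.Δ₁ : ℤˣ) : ℤ) * ((C.Δ₀ * C.Δ₁ : ℤˣ) : ℤ) = 1 := by
    rcases Int.units_eq_one_or (C.Δ₀ * C.Δ₁) with h | h <;> simp [h]
  induction a, ha using CliffordAlgebra.even_induction with
  | algebraMap r =>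
    intro φ ψ
    have h1 : ∀ χ : F, ρ.act (algebraMap ℝ _ r) χ = (algebraMap ℝ 𝕜 r) • χ := by
      intro χ
      rw [AlgHom.commutes, Module.algebraMap_end_apply, algebraMap_smul]
    rw [CliffordAlgebra.star_algebraMap, h1, h1]
    simp
  | add x y _ _ hx hy => intro φ ψ; simp [hx φ ψ, hy φ ψ]
  | ι_mul_ι_mul v w x _ hx =>
    intro φ ψ
    simp only [star_mul, CliffordAlgebra.star_ι, map_mul, Module.End.mul_apply]
    rw [C.form_act_ι, C.form_act_ι, hx, smul_smul, hs, one_smul]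
    simp

/-- The charge conjugation is spin-invariant. -/
theorem form_spin {h : CliffordAlgebra (cliffordForm ε)} (hh : h ∈ spinGroup (cliffordForm ε))
    (φ ψ : F) : C.form (ρ.act h φ) (ρ.act h ψ) = C.form φ ψ := by
  rw [C.form_act_even h (spinGroup.mem_even hh), ← Module.End.mul_apply, ← map_mul,
    spinGroup.star_mul_self_of_mem hh]
  simp

end ChargeConjugation

/-! ### Pseudo-Riemannian metrics and the Levi-Civita connection -/

section Metric

variable (E : Type*) [NormedAddCommGroup E] [NormedSpace ℝ E]
  (M : Type*) [TopologicalSpace M] [ChartedSpace E M] [IsManifold 𝓘(ℝ, E) ∞ M]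

/-- A smooth pseudo-Riemannian metric on `M`. -/
structure PseudoRiemannianMetric where
  inner (x : M) : TangentSpace 𝓘(ℝ, E) x →L[ℝ] TangentSpace 𝓘(ℝ, E) x →L[ℝ] ℝ
  symm (x : M) (v w : TangentSpace 𝓘(ℝ, E) x) : inner x v w = inner x w v
  nondegenerate (x : M) (v : TangentSpace 𝓘(ℝ, E) x) (hv : ∀ w, inner x v w = 0) : v = 0
  contMDiff : ContMDiff 𝓘(ℝ, E) (𝓘(ℝ, E).prod 𝓘(ℝ, E →L[ℝ] E →L[ℝ] ℝ)) ∞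
    (fun x ↦ Bundle.TotalSpace.mk' (E →L[ℝ] E →L[ℝ] ℝ) x (inner x))

variable {E M}

/-- A connection on the tangent bundle is the Levi-Civita connection of `g` if it is metric,
`Z g(X, Y) = g(∇_Z X, Y) + g(X, ∇_Z Y)`, and torsion free, `∇_X Y - ∇_Y X = [X, Y]`. -/
structure IsLeviCivita (g : PseudoRiemannianMetric E M)
    (nabla : CovariantDerivative 𝓘(ℝ, E) E (TangentSpace 𝓘(ℝ, E) : M → Type _)) : Prop where
  metric : ∀ (x : M) (X Y : Π y : M, TangentSpace 𝓘(ℝ, E) y) (Z : TangentSpace 𝓘(ℝ, E) x),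
    MDiffAt (T% X) x → MDiffAt (T% Y) x →
      (mfderiv% (fun y => g.inner y (X y) (Y y)) x Z : ℝ) =
        g.inner x (nabla X x Z) (Y x) + g.inner x (X x) (nabla Y x Z)
  torsion_free : ∀ (x : M) (X Y : Π y : M, TangentSpace 𝓘(ℝ, E) y),
    MDiffAt (T% X) x → MDiffAt (T% Y) x →
      nabla Y x (X x) - nabla X x (Y x) = VectorField.mlieBracket 𝓘(ℝ, E) X Y x

end Metric

/-! ### Alternating forms -/

section Forms

variable {𝕜 : Type*} [RCLike 𝕜] {T : Type*} [AddCommGroup T] [Module ℝ T]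

/-- `X ∧ G`, where the vector `X` is identified with the one-form `B X` by the metric `B`, and `G`
is a form of degree `ℓ - 1`.  There are no forms of degree `-1`, so it is `0` for `ℓ = 0`. -/
def wedge (B : T →ₗ[ℝ] T →ₗ[ℝ] ℝ) :
    (ℓ : ℕ) → T → (T [⋀^Fin (ℓ - 1)]→ₗ[ℝ] 𝕜) → (T [⋀^Fin ℓ]→ₗ[ℝ] 𝕜)
  | 0, _, _ => 0
  | _ + 1, X, G => AlternatingMap.alternatizeUncurryFin ((B X).smulRight G)

/-- The metric trace `∑_a ε_a e_a ⌟ α(e_a)` of an element `α` of `T* ⊗ Λ^ℓ T*`, in terms of an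
orthonormal basis `e` with `g(e_a, e_b) = ε_a δ_ab`.  It does not depend on the basis. -/
def formTrace {n : ℕ} (ε : Fin n → ℤˣ) (e : Fin n → T) :
    (ℓ : ℕ) → (T →ₗ[ℝ] T [⋀^Fin ℓ]→ₗ[ℝ] 𝕜) → (T [⋀^Fin (ℓ - 1)]→ₗ[ℝ] 𝕜)
  | 0, _ => 0
  | _ + 1, α => ∑ a, sgn (ε a) • (α (e a)).curryLeft (e a)

/-- The endomorphism `(1/ℓ!) w_{μ₁…μ_ℓ} γ^{μ₁} ⋯ γ^{μ_ℓ}` given by an `ℓ`-form `w`, in terms of an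
orthonormal basis `e` with `g(e_a, e_b) = ε_a δ_ab` and of `γ_a`, the Clifford multiplication
by `e_a`.  It does not depend on the basis.  Since `w` is alternating, only the skew symmetrized
products `γ^{[μ₁} ⋯ γ^{μ_ℓ]}` enter. -/
def cliffordOfForm {S : Type*} [AddCommGroup S] [Module 𝕜 S] {n : ℕ} (ε : Fin n → ℤˣ)
    (e : Fin n → T) (γ : T → Module.End 𝕜 S) {ℓ : ℕ} (w : T [⋀^Fin ℓ]→ₗ[ℝ] 𝕜) : Module.End 𝕜 S :=
  ((ℓ.factorial : 𝕜)⁻¹) • ∑ I : Fin ℓ → Fin n,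
    (((∏ j, sgn (ε (I j)) : ℝ) : 𝕜) * w (fun j => e (I j))) •
      (List.ofFn fun j => γ (e (I j))).prod

end Forms

/-! ### Spin structures and spinor bundles -/

section Spin

variable {𝕜 : Type*} [RCLike 𝕜]
  {E : Type*} [NormedAddCommGroup E] [NormedSpace ℝ E]
  {M : Type*} [TopologicalSpace M] [ChartedSpace E M] [IsManifold 𝓘(ℝ, E) ∞ M]
  {F : Type*} [NormedAddCommGroup F] [NormedSpace ℝ F] [NormedSpace 𝕜 F] [IsScalarTower ℝ 𝕜 F]
  {n : ℕ} {ε : Fin n → ℤˣ}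

/-- A frame of `T_x M` together with a frame of the fibre `S_x` of a vector bundle. -/
abbrev FramePair (𝕜 : Type*) [RCLike 𝕜] {E : Type*} [NormedAddCommGroup E] [NormedSpace ℝ E]
    {M : Type*} [TopologicalSpace M] [ChartedSpace E M] (F : Type*) [NormedAddCommGroup F]
    [NormedSpace 𝕜 F] (n : ℕ) (S : M → Type*) [∀ x, AddCommGroup (S x)] [∀ x, Module 𝕜 (S x)]
    (x : M) :=
  ((Fin n → ℝ) ≃ₗ[ℝ] TangentSpace 𝓘(ℝ, E) x) × (F ≃ₗ[𝕜] S x)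

variable {S : M → Type*} [∀ x, AddCommGroup (S x)] [∀ x, Module 𝕜 (S x)]

/-- `q = p · h`: the frame pair `q = (e', θ')` arises from `p = (e, θ)` by the right action of the
element `h` of the spin group, i.e. `θ' = θ ∘ ρ(h)` and `e' = e ∘ λ(h)` with
`λ(h) v = h v h⁻¹` (where `h⁻¹ = star h`). -/
def SpinRelated (ρ : SpinorModule 𝕜 F ε) {x : M} (p : FramePair 𝕜 (E := E) F n S x)
    (h : CliffordAlgebra (cliffordForm ε)) (q : FramePair 𝕜 (E := E) F n S x) : Prop :=
  (∀ ψ, q.2 ψ = p.2 (ρ.act h ψ)) ∧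
    ∀ v, CliffordAlgebra.ι (cliffordForm ε) (p.1.symm (q.1 v)) =
      h * CliffordAlgebra.ι (cliffordForm ε) v * star h

variable [TopologicalSpace (Bundle.TotalSpace F S)]
  [∀ x, TopologicalSpace (S x)] [FiberBundle F S]

variable (S) in
/-- A spin structure on the pseudo-Riemannian manifold `(M, g)` with associated spinor
bundle `S`: a principal bundle `P` for the spin group, whose elements over `x` are given by the
orthonormal frames of `T_x M` and the frames of `S_x` which they define, on which the spin group
acts simply transitively and which has smooth local sections. -/
structure SpinStructure (g : PseudoRiemannianMetric E M) (ρ : SpinorModule 𝕜 F ε) where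
  P (x : M) : Set (FramePair 𝕜 (E := E) F n S x)
  orthonormal {x : M} {p : FramePair 𝕜 (E := E) F n S x} (hp : p ∈ P x) (v w : Fin n → ℝ) :
    g.inner x (p.1 v) (p.1 w) = modelInner ε v w
  mem_iff {x : M} {p : FramePair 𝕜 (E := E) F n S x} (hp : p ∈ P x)
    (q : FramePair 𝕜 (E := E) F n S x) :
    q ∈ P x ↔ ∃ h ∈ spinGroup (cliffordForm ε), SpinRelated ρ p h q
  exists_section (x : M) : ∃ U : Set M, IsOpen U ∧ x ∈ U ∧
    ∃ s : Π y : M, FramePair 𝕜 (E := E) F n S y, (∀ y ∈ U, s y ∈ P y) ∧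
      (∀ v, ContMDiffOn 𝓘(ℝ, E) (𝓘(ℝ, E).prod 𝓘(ℝ, E)) ∞
        (fun y => Bundle.TotalSpace.mk' E (E := (TangentSpace 𝓘(ℝ, E) : M → Type _)) y
          ((s y).1 v)) U) ∧
      (∀ ψ, ContMDiffOn 𝓘(ℝ, E) (𝓘(ℝ, E).prod 𝓘(ℝ, F)) ∞
        (fun y => Bundle.TotalSpace.mk' F (E := S) y ((s y).2 ψ)) U)

namespace SpinStructure

variable {g : PseudoRiemannianMetric E M} {ρ : SpinorModule 𝕜 F ε}
  (σ : SpinStructure (𝕜 := 𝕜) S g ρ)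

theorem nonempty (x : M) : (σ.P x).Nonempty := by
  obtain ⟨U, _, hx, s, hs, _⟩ := σ.exists_section x
  exact ⟨s x, hs x hx⟩

/-- A (chosen) element of the spin bundle over `x`. -/
def framePair (x : M) : FramePair 𝕜 (E := E) F n S x := (σ.nonempty x).choose

theorem framePair_mem (x : M) : σ.framePair x ∈ σ.P x := (σ.nonempty x).choose_spec

/-- The `a`-th vector of the chosen orthonormal frame of `T_x M`. -/
def e (x : M) (a : Fin n) : TangentSpace 𝓘(ℝ, E) x := (σ.framePair x).1 (Pi.single a 1)

/-- A local spin frame: a smooth local section of the spin bundle over an open set `U`. -/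
structure IsSpinFrame (U : Set M) (s : Π y : M, FramePair 𝕜 (E := E) F n S y) : Prop where
  isOpen : IsOpen U
  mem : ∀ y ∈ U, s y ∈ σ.P y
  contMDiffOn_fst : ∀ v, ContMDiffOn 𝓘(ℝ, E) (𝓘(ℝ, E).prod 𝓘(ℝ, E)) ∞
    (fun y => Bundle.TotalSpace.mk' E (E := (TangentSpace 𝓘(ℝ, E) : M → Type _)) y ((s y).1 v)) U
  contMDiffOn_snd : ∀ ψ, ContMDiffOn 𝓘(ℝ, E) (𝓘(ℝ, E).prod 𝓘(ℝ, F)) ∞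
    (fun y => Bundle.TotalSpace.mk' F (E := S) y ((s y).2 ψ)) U

/-- The Clifford multiplication `γ(X) : S_x → S_x` by a tangent vector `X ∈ T_x M`. -/
def gamma (x : M) : TangentSpace 𝓘(ℝ, E) x → Module.End 𝕜 (S x) := fun X =>
  (σ.framePair x).2.conj
    (ρ.act (CliffordAlgebra.ι (cliffordForm ε) ((σ.framePair x).1.symm X)))

/-- The Clifford multiplication can be computed in every spin frame. -/
theorem gamma_apply {x : M} {p : FramePair 𝕜 (E := E) F n S x} (hp : p ∈ σ.P x)
    (v : Fin n → ℝ) (ψ : F) :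
    σ.gamma x (p.1 v) (p.2 ψ) = p.2 (ρ.act (CliffordAlgebra.ι (cliffordForm ε) v) ψ) := by
  obtain ⟨h, hh, h2, h1⟩ := (σ.mem_iff (σ.framePair_mem x) p).1 hp
  rw [gamma, LinearEquiv.conj_apply_apply, h1, h2, LinearEquiv.symm_apply_apply, h2,
    ← Module.End.mul_apply, ← map_mul, mul_assoc, spinGroup.star_mul_self_of_mem hh, mul_one,
    map_mul, Module.End.mul_apply]

/-- The bilinear form on `S_x` given by a charge conjugation. -/
def form (C : ChargeConjugation ρ) (x : M) : LinearMap.BilinForm 𝕜 (S x) :=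
  LinearMap.BilinForm.congr (σ.framePair x).2 C.form

/-- The charge conjugation can be computed in every spin frame. -/
theorem form_apply (C : ChargeConjugation ρ) {x : M} {p : FramePair 𝕜 (E := E) F n S x}
    (hp : p ∈ σ.P x) (φ ψ : F) : σ.form C x (p.2 φ) (p.2 ψ) = C.form φ ψ := by
  obtain ⟨h, hh, h2, _⟩ := (σ.mem_iff (σ.framePair_mem x) p).1 hp
  rw [form, LinearMap.BilinForm.congr_apply, h2, h2, LinearEquiv.symm_apply_apply,
    LinearEquiv.symm_apply_apply, C.form_spin hh]

/-- The charge adjoint `Φ^C` of an endomorphism `Φ` of `S_x`, given by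
`C(Φ^C η, ξ) = C(η, Φ ξ)`. -/
def adjoint [FiniteDimensional 𝕜 F] (C : ChargeConjugation ρ) (x : M) (Φ : Module.End 𝕜 (S x)) :
    Module.End 𝕜 (S x) :=
  (σ.framePair x).2.conj
    (C.form.leftAdjointOfNondegenerate C.nondegenerate ((σ.framePair x).2.symm.conj Φ))

theorem form_adjoint [FiniteDimensional 𝕜 F] (C : ChargeConjugation ρ) (x : M)
    (Φ : Module.End 𝕜 (S x)) (η ξ : S x) :
    σ.form C x (σ.adjoint C x Φ η) ξ = σ.form C x η (Φ ξ) := by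
  have := C.form.isAdjointPairLeftAdjointOfNondegenerate C.nondegenerate
    ((σ.framePair x).2.symm.conj Φ) ((σ.framePair x).2.symm η) ((σ.framePair x).2.symm ξ)
  simpa [form, adjoint, LinearEquiv.conj_apply_apply] using this

variable [∀ x, Module ℝ (S x)] [∀ x, IsScalarTower ℝ 𝕜 (S x)]
  [∀ x, IsTopologicalAddGroup (S x)] [∀ x, ContinuousSMul ℝ (S x)]

/-- A connection on `S` is the (spinorial) Levi-Civita connection, if in every local spin frame
`(e, θ)` it is given by `∇_X θ_ψ = ¼ ∑_{a,b} ε_a ε_b g(∇_X e_a, e_b) e_a · e_b · θ_ψ`, i.e. if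
its connection form is the lift to the spin group of the connection form of the Levi-Civita
connection `nabla` of `g`. -/
def IsSpinLeviCivita
    (nabla : CovariantDerivative 𝓘(ℝ, E) E (TangentSpace 𝓘(ℝ, E) : M → Type _))
    (nablaS : CovariantDerivative 𝓘(ℝ, E) F S) : Prop :=
  ∀ (U : Set M) (s : Π y : M, FramePair 𝕜 (E := E) F n S y), σ.IsSpinFrame U s →
    ∀ x ∈ U, ∀ (X : TangentSpace 𝓘(ℝ, E) x) (ψ : F),
      nablaS (fun y => (s y).2 ψ) x X =
        (1 / 4 : ℝ) • ∑ a, ∑ b,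
          (sgn (ε a) * sgn (ε b) *
            g.inner x (nabla (fun y => (s y).1 (Pi.single a 1)) x X) ((s x).1 (Pi.single b 1))) •
            σ.gamma x ((s x).1 (Pi.single a 1)) (σ.gamma x ((s x).1 (Pi.single b 1)) ((s x).2 ψ))

/-- `𝒜 = D - ∇`, as a one-form with values in the (`𝕜`-linear) endomorphisms of `S`. -/
def IsDifference (D nablaS : CovariantDerivative 𝓘(ℝ, E) F S)
    (A : Π x : M, TangentSpace 𝓘(ℝ, E) x →ₗ[ℝ] S x →ₗ[𝕜] S x) : Prop :=
  ∀ (x : M) (ξ : Π y : M, S y) (X : TangentSpace 𝓘(ℝ, E) x), MDiffAt (T% ξ) x →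
    A x X (ξ x) = D ξ x X - nablaS ξ x X

/-- The connection `D^C = ∇ - 𝒜^C` associated to `D = ∇ + 𝒜`, i.e. the one for which
`D ⊗ 1 + 1 ⊗ D^C` makes the charge conjugation parallel. -/
def conjConnection [FiniteDimensional 𝕜 F] (C : ChargeConjugation ρ)
    (nablaS : CovariantDerivative 𝓘(ℝ, E) F S)
    (A : Π x : M, TangentSpace 𝓘(ℝ, E) x →ₗ[ℝ] S x →ₗ[𝕜] S x)
    (ξ : Π y : M, S y) (x : M) (X : TangentSpace 𝓘(ℝ, E) x) : S x :=
  nablaS ξ x X - σ.adjoint C x (A x X) (ξ x)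

/-- `(D̂_Z γ)(X) ξ = D_Z (γ(X) ξ) - γ(∇_Z X) ξ - γ(X) D^C_Z ξ`, at the point `x`. -/
def hatDGamma [FiniteDimensional 𝕜 F] (C : ChargeConjugation ρ)
    (nabla : CovariantDerivative 𝓘(ℝ, E) E (TangentSpace 𝓘(ℝ, E) : M → Type _))
    (nablaS D : CovariantDerivative 𝓘(ℝ, E) F S)
    (A : Π x : M, TangentSpace 𝓘(ℝ, E) x →ₗ[ℝ] S x →ₗ[𝕜] S x)
    (Z X : Π y : M, TangentSpace 𝓘(ℝ, E) y) (ξ : Π y : M, S y) (x : M) : S x :=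
  D (fun y => σ.gamma y (X y) (ξ y)) x (Z x) - σ.gamma x (nabla X x (Z x)) (ξ x)
    - σ.gamma x (X x) (σ.conjConnection C nablaS A ξ x (Z x))

/-- `D` is admissible if `D̂γ` is skew symmetric, `(D̂_Z γ)(X) = -(D̂_X γ)(Z)`. -/
def IsAdmissible [FiniteDimensional 𝕜 F] (C : ChargeConjugation ρ)
    (nabla : CovariantDerivative 𝓘(ℝ, E) E (TangentSpace 𝓘(ℝ, E) : M → Type _))
    (nablaS D : CovariantDerivative 𝓘(ℝ, E) F S)
    (A : Π x : M, TangentSpace 𝓘(ℝ, E) x →ₗ[ℝ] S x →ₗ[𝕜] S x) : Prop :=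
  ∀ (x : M) (Z X : Π y : M, TangentSpace 𝓘(ℝ, E) y) (ξ : Π y : M, S y),
    MDiffAt (T% Z) x → MDiffAt (T% X) x → MDiffAt (T% ξ) x →
      σ.hatDGamma C nabla nablaS D A Z X ξ x = -σ.hatDGamma C nabla nablaS D A X Z ξ x

/-- The endomorphism of `S_x` given by an `ℓ`-form on `T_x M`, see `cliffordOfForm`. -/
def ofForm (x : M) {ℓ : ℕ} (w : TangentSpace 𝓘(ℝ, E) x [⋀^Fin ℓ]→ₗ[ℝ] 𝕜) : Module.End 𝕜 (S x) :=
  cliffordOfForm ε (σ.e x) (σ.gamma x) w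

/-- `𝒜` is homogeneous of degree `ℓ`: every `𝒜_X` is given by an `ℓ`-form. -/
def IsHomogeneous (A : Π x : M, TangentSpace 𝓘(ℝ, E) x →ₗ[ℝ] S x →ₗ[𝕜] S x) (ℓ : ℕ) : Prop :=
  ∀ (x : M) (X : TangentSpace 𝓘(ℝ, E) x),
    ∃ w : TangentSpace 𝓘(ℝ, E) x [⋀^Fin ℓ]→ₗ[ℝ] 𝕜, A x X = σ.ofForm x w

/-- The metric of `T_x M` as a bilinear map. -/
def metric (g : PseudoRiemannianMetric E M) (x : M) :
    TangentSpace 𝓘(ℝ, E) x →ₗ[ℝ] TangentSpace 𝓘(ℝ, E) x →ₗ[ℝ] ℝ :=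
  (ContinuousLinearMap.coeLM ℝ) ∘ₗ (g.inner x : _ →ₗ[ℝ] _)

/-- The decomposition `𝒜_X = X ⌟ F + X ∧ G + 𝒜₀(X)` of a homogeneous `𝒜` of degree `ℓ`
according to `Ω¹ ⊗ Ω^ℓ = Ω^{ℓ+1} ⊕ Ω^{ℓ-1} ⊕ Ω^{(ℓ,1)}`.  The last summand consists of the tensors
with vanishing skew symmetrization and vanishing metric trace. -/
structure IsDecomposition (A : Π x : M, TangentSpace 𝓘(ℝ, E) x →ₗ[ℝ] S x →ₗ[𝕜] S x) (ℓ : ℕ)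
    (Fform : Π x : M, TangentSpace 𝓘(ℝ, E) x [⋀^Fin (ℓ + 1)]→ₗ[ℝ] 𝕜)
    (Gform : Π x : M, TangentSpace 𝓘(ℝ, E) x [⋀^Fin (ℓ - 1)]→ₗ[ℝ] 𝕜)
    (A₀ : Π x : M, TangentSpace 𝓘(ℝ, E) x →ₗ[ℝ] TangentSpace 𝓘(ℝ, E) x [⋀^Fin ℓ]→ₗ[ℝ] 𝕜) :
    Prop where
  /-- there are no forms of degree `-1` -/
  lower_eq_zero : ℓ = 0 → Gform = 0
  alternation_eq_zero : ∀ x, AlternatingMap.alternatizeUncurryFin (A₀ x) = 0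
  trace_eq_zero : ∀ x, formTrace ε (σ.e x) ℓ (A₀ x) = 0
  eq : ∀ (x : M) (X : TangentSpace 𝓘(ℝ, E) x),
    A x X = σ.ofForm x ((Fform x).curryLeft X + wedge (metric g x) ℓ X (Gform x) + A₀ x X)

end SpinStructure

end Spin

end SpinGeometry

end

/-! Since Clifford multiplication is parallel for the Levi-Civita connections, all derivatives
cancel in `hatDGamma`, and there remains $\mathcal A_Z X+X\mathcal A_Z^C$ (`hatDGamma_eq`). This is
bilinear in $Z$ and $X$, so it is skew exactly when $\mathcal A_Z Z+Z\mathcal A_Z^C=0$ for every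
tangent vector $Z$: admissibility is a pointwise algebraic condition (`isAdmissible_iff`).

Let $\mathcal A_Z$ be given by the $\ell$-form $\alpha(Z)$. The charge adjoint multiplies it by the
sign $\tau=\Delta_0\Delta_\ell$ (`adjoint_ofForm`, `adjointSign_sgn`). From $Z\cdot w=Z\wedge
w-Z\rfloor w$ and $w\cdot Z=(-1)^\ell(Z\wedge w+Z\rfloor w)$ (`clifford_mul`, `clifford_mul_right`)
the condition becomes $((-1)^\ell+\tau)\,Z\wedge\alpha(Z)+((-1)^\ell-\tau)\,Z\rfloor\alpha(Z)=0$.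
One coefficient vanishes and the other is $\pm2$. As forms of a fixed degree act faithfully
(`cliffordLM_injective`), either $Z\wedge\alpha(Z)=0$ for all $Z$, and polarizing and tracing gives
$\alpha(Z)=Z\wedge G$; or $Z\rfloor\alpha(Z)=0$ for all $Z$, and the Leibniz rule gives
$\alpha(Z)=Z\rfloor F$. Both implications reverse (`anticommute_iff`).

The decomposition itself comes from alternation and metric trace: alternation kills $Z\wedge G$ and
is $\ell+1$ on $Z\rfloor F$, while the trace kills $Z\rfloor F$ and is $n-\ell+1\ne0$ on $Z\wedge
G$. Finally $\tau=\mp(-1)^\ell$ is translated into $\Delta_1\Delta_{\ell\pm1}=-1$ by the periodicity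
of $\Delta_k$ modulo 4. -/

namespace SpinGeometry

noncomputable section

section

open AlternatingMap

/-! ### Contraction and exterior multiplication of alternating forms -/

section FormAlgebra

variable {𝕜 : Type*} [RCLike 𝕜] {T : Type*} [AddCommGroup T] [Module ℝ T]

/-- The contraction `X ⌟ w` of a form of arbitrary degree, with value `0` in degree `0`. -/
def contract : {ℓ : ℕ} → T → (T [⋀^Fin ℓ]→ₗ[ℝ] 𝕜) → (T [⋀^Fin (ℓ - 1)]→ₗ[ℝ] 𝕜)
  | 0, _, _ => 0
  | _ + 1, X, w => w.curryLeft X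

@[simp]
theorem contract_succ {ℓ : ℕ} (X : T) (w : T [⋀^Fin (ℓ + 1)]→ₗ[ℝ] 𝕜) :
    contract X w = w.curryLeft X := rfl

@[simp]
theorem contract_of_degree_zero (X : T) (w : T [⋀^Fin 0]→ₗ[ℝ] 𝕜) : contract X w = 0 := rfl

theorem contract_add_right {ℓ : ℕ} (X : T) (v w : T [⋀^Fin ℓ]→ₗ[ℝ] 𝕜) :
    contract X (v + w) = contract X v + contract X w := by
  cases ℓ <;> simp

theorem contract_smul_right {ℓ : ℕ} (X : T) (r : ℝ) (w : T [⋀^Fin ℓ]→ₗ[ℝ] 𝕜) :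
    contract X (r • w) = r • contract X w := by
  cases ℓ <;> simp

theorem contract_add_left {ℓ : ℕ} (X Y : T) (w : T [⋀^Fin ℓ]→ₗ[ℝ] 𝕜) :
    contract (X + Y) w = contract X w + contract Y w := by
  cases ℓ <;> simp

theorem contract_smul_left {ℓ : ℕ} (r : ℝ) (X : T) (w : T [⋀^Fin ℓ]→ₗ[ℝ] 𝕜) :
    contract (r • X) w = r • contract X w := by
  cases ℓ <;> simp

/-- The contraction as a bilinear map. -/
def contractLM (𝕜 : Type*) [RCLike 𝕜] (T : Type*) [AddCommGroup T] [Module ℝ T] (ℓ : ℕ) :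
    T →ₗ[ℝ] (T [⋀^Fin ℓ]→ₗ[ℝ] 𝕜) →ₗ[ℝ] (T [⋀^Fin (ℓ - 1)]→ₗ[ℝ] 𝕜) :=
  LinearMap.mk₂ ℝ contract contract_add_left contract_smul_left contract_add_right
    fun r X w => contract_smul_right X r w

theorem contract_contract_self {ℓ : ℕ} (X : T) (w : T [⋀^Fin ℓ]→ₗ[ℝ] 𝕜) :
    contract X (contract X w) = 0 := by
  match ℓ, w with
  | 0, _ => rfl
  | 1, _ => rfl
  | ℓ + 2, w => exact w.curryLeft_same X

theorem contract_contract {ℓ : ℕ} (X Y : T) (w : T [⋀^Fin ℓ]→ₗ[ℝ] 𝕜) :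
    contract X (contract Y w) = -contract Y (contract X w) := by
  have h := contract_contract_self (X + Y) w
  simp only [contract_add_left, contract_add_right, contract_contract_self, zero_add,
    add_zero] at h
  exact eq_neg_of_add_eq_zero_right h

/-- The exterior product with the one-form dual to `X`, in every degree. -/
def wedgeLM (𝕜 : Type*) [RCLike 𝕜] {T : Type*} [AddCommGroup T] [Module ℝ T]
    (B : T →ₗ[ℝ] T →ₗ[ℝ] ℝ) (ℓ : ℕ) :
    T →ₗ[ℝ] (T [⋀^Fin ℓ]→ₗ[ℝ] 𝕜) →ₗ[ℝ] (T [⋀^Fin (ℓ + 1)]→ₗ[ℝ] 𝕜) :=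
  LinearMap.mk₂ ℝ (fun X w => alternatizeUncurryFin ((B X).smulRight w))
    (fun X Y w => by
      rw [← alternatizeUncurryFin_add]; congr 1; ext; simp [add_smul])
    (fun r X w => by
      rw [← alternatizeUncurryFin_smul]; congr 1; ext; simp [mul_smul])
    (fun X v w => by
      rw [← alternatizeUncurryFin_add]; congr 1; ext; simp)
    (fun r X w => by
      rw [← alternatizeUncurryFin_smul]; congr 1; ext; simp [smul_comm r])

theorem wedgeLM_apply (B : T →ₗ[ℝ] T →ₗ[ℝ] ℝ) {ℓ : ℕ} (X : T) (w : T [⋀^Fin ℓ]→ₗ[ℝ] 𝕜) :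
    wedgeLM 𝕜 B ℓ X w = alternatizeUncurryFin ((B X).smulRight w) := rfl

theorem wedge_succ (B : T →ₗ[ℝ] T →ₗ[ℝ] ℝ) {ℓ : ℕ} (X : T) (w : T [⋀^Fin ℓ]→ₗ[ℝ] 𝕜) :
    wedge B (ℓ + 1) X w = wedgeLM 𝕜 B ℓ X w := rfl

/-- The Leibniz rule `X ⌟ alt α = α X - alt (X ⌟ α)`. -/
theorem curryLeft_alternatizeUncurryFin {ℓ : ℕ}
    (α : T →ₗ[ℝ] T [⋀^Fin (ℓ + 1)]→ₗ[ℝ] 𝕜) (X : T) :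
    (alternatizeUncurryFin α).curryLeft X =
      α X - alternatizeUncurryFin (n := ℓ) (contractLM 𝕜 T (ℓ + 1) X ∘ₗ α) := by
  ext v
  -- The summand of index 0 feeds `X` to `α` itself. In the others `X` stays in the first slot of
  -- the form, and the index shift produces the minus sign.
  rw [curryLeft_apply_apply, alternatizeUncurryFin_apply, Fin.sum_univ_succ, AlternatingMap.sub_apply,
    alternatizeUncurryFin_apply, sub_eq_add_neg, ← Finset.sum_neg_distrib]
  congr 1
  · simp [Matrix.vecCons]
  · refine Finset.sum_congr rfl fun i _ => ?_
    simp only [Matrix.cons_val_succ, Fin.val_succ, pow_succ, mul_neg, mul_one, neg_smul, neg_inj]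
    congr 1
    simp only [LinearMap.comp_apply, contractLM, LinearMap.mk₂_apply, contract_succ,
      curryLeft_apply_apply]
    congr 1
    ext j
    refine Fin.cases ?_ (fun j => ?_) j <;> simp [Fin.removeNth]

/-- Degree 0 is separate because truncated subtraction would give the correction term of the Leibniz
rule the wrong degree. -/
theorem curryLeft_alternatizeUncurryFin_zero
    (α : T →ₗ[ℝ] T [⋀^Fin 0]→ₗ[ℝ] 𝕜) (X : T) :
    (alternatizeUncurryFin α).curryLeft X = α X := by
  ext v
  rw [curryLeft_apply_apply, alternatizeUncurryFin_apply]
  simp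

/-- `X ⌟ (Z ∧ w) = ⟨Z, X⟩ w - Z ∧ (X ⌟ w)` in positive degree. -/
theorem curryLeft_wedgeLM {ℓ : ℕ} (B : T →ₗ[ℝ] T →ₗ[ℝ] ℝ) (X Z : T)
    (w : T [⋀^Fin (ℓ + 1)]→ₗ[ℝ] 𝕜) :
    (wedgeLM 𝕜 B (ℓ + 1) Z w).curryLeft X =
      B Z X • w - wedgeLM 𝕜 B ℓ Z (w.curryLeft X) := by
  rw [wedgeLM_apply, curryLeft_alternatizeUncurryFin, wedgeLM_apply]
  rfl

theorem curryLeft_wedgeLM_zero (B : T →ₗ[ℝ] T →ₗ[ℝ] ℝ) (X Z : T)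
    (w : T [⋀^Fin 0]→ₗ[ℝ] 𝕜) :
    (wedgeLM 𝕜 B 0 Z w).curryLeft X = B Z X • w := by
  rw [wedgeLM_apply, curryLeft_alternatizeUncurryFin_zero]
  rfl

/-- `X ↦ X ∧ w` has vanishing skew symmetrization. -/
theorem alternatizeUncurryFin_wedgeLM {ℓ : ℕ} {B : T →ₗ[ℝ] T →ₗ[ℝ] ℝ}
    (hB : ∀ X Y, B X Y = B Y X) (w : T [⋀^Fin ℓ]→ₗ[ℝ] 𝕜) :
    alternatizeUncurryFin ((wedgeLM 𝕜 B ℓ).flip w) = 0 := by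
  -- The map is the alternation of $X\otimes Y\mapsto\langle X,Y\rangle w$ in one argument;
  -- alternating the other one too kills it, since it is symmetric.
  let f : T →ₗ[ℝ] T →ₗ[ℝ] T [⋀^Fin ℓ]→ₗ[ℝ] 𝕜 :=
    LinearMap.mk₂ ℝ (fun X Y => B X Y • w) (by simp [add_smul]) (by simp [mul_smul])
      (by simp [add_smul]) (by simp [mul_smul])
  have hf : (wedgeLM 𝕜 B ℓ).flip w = alternatizeUncurryFinLM ∘ₗ f := by
    ext1 X
    rfl
  rw [hf]
  exact alternatizeUncurryFin_alternatizeUncurryFinLM_comp_of_symmetric fun X Y => by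
    simp [f, hB X Y]

end FormAlgebra

end

/-! ### Orthonormal frames, the metric trace and skew symmetrization -/

section

open AlternatingMap

theorem sgn_mul_self (s : ℤˣ) : sgn s * sgn s = 1 := by
  rcases Int.units_eq_one_or s with h | h <;> simp [h, sgn]

/-- The vectors `e_a` form an orthonormal basis for the symmetric bilinear form `B`, with
`B(e_a, e_b) = ε_a δ_ab`. -/
structure IsOrthonormalFrame {T : Type*} [AddCommGroup T] [Module ℝ T] {n : ℕ} (ε : Fin n → ℤˣ)
    (e : Fin n → T) (B : T →ₗ[ℝ] T →ₗ[ℝ] ℝ) : Prop where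
  symm : ∀ X Y, B X Y = B Y X
  norm : ∀ a, B (e a) (e a) = sgn (ε a)
  expand : ∀ X, ∑ a, (sgn (ε a) * B (e a) X) • e a = X

section Trace

variable {𝕜 : Type*} [RCLike 𝕜] {T : Type*} [AddCommGroup T] [Module ℝ T]
  {n : ℕ} {ε : Fin n → ℤˣ} {e : Fin n → T} {B : T →ₗ[ℝ] T →ₗ[ℝ] ℝ}

theorem IsOrthonormalFrame.sum_smul_map (h : IsOrthonormalFrame ε e B) {V : Type*}
    [AddCommGroup V] [Module ℝ V] (f : T →ₗ[ℝ] V) (X : T) :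
    ∑ a, (sgn (ε a) * B (e a) X) • f (e a) = f X := by
  conv_rhs => rw [← h.expand X]
  simp

theorem formTrace_succ {ℓ : ℕ} (α : T →ₗ[ℝ] T [⋀^Fin (ℓ + 1)]→ₗ[ℝ] 𝕜) :
    formTrace ε e (ℓ + 1) α = ∑ a, sgn (ε a) • (α (e a)).curryLeft (e a) := rfl

theorem formTrace_eq_sum_contract {ℓ : ℕ} (α : T →ₗ[ℝ] T [⋀^Fin ℓ]→ₗ[ℝ] 𝕜) :
    formTrace ε e ℓ α = ∑ a, sgn (ε a) • contract (e a) (α (e a)) := by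
  cases ℓ
  · simp [formTrace]
  · rfl

theorem formTrace_add {ℓ : ℕ} (α β : T →ₗ[ℝ] T [⋀^Fin ℓ]→ₗ[ℝ] 𝕜) :
    formTrace ε e ℓ (α + β) = formTrace ε e ℓ α + formTrace ε e ℓ β := by
  simp [formTrace_eq_sum_contract, contract_add_right, Finset.sum_add_distrib]

theorem formTrace_curryLeft {ℓ : ℕ} (w : T [⋀^Fin (ℓ + 1)]→ₗ[ℝ] 𝕜) :
    formTrace ε e ℓ w.curryLeft = 0 := by
  rw [formTrace_eq_sum_contract]
  refine Finset.sum_eq_zero fun a _ => ?_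
  have : contract (e a) (w.curryLeft (e a)) = 0 := contract_contract_self (e a) w
  rw [this, smul_zero]

/-- `∑ ε_a e_a ∧ α(e_a) = alt α`. -/
theorem IsOrthonormalFrame.sum_wedgeLM (h : IsOrthonormalFrame ε e B) {ℓ : ℕ}
    (α : T →ₗ[ℝ] T [⋀^Fin ℓ]→ₗ[ℝ] 𝕜) :
    ∑ a, sgn (ε a) • wedgeLM 𝕜 B ℓ (e a) (α (e a)) = alternatizeUncurryFin α := by
  have h1 : α = ∑ a, sgn (ε a) • (B (e a)).smulRight (α (e a)) := by
    ext1 X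
    rw [← h.sum_smul_map α X]
    simp [mul_smul]
  conv_rhs => rw [h1]
  rw [← alternatizeUncurryFinLM_apply, map_sum]
  simp [wedgeLM_apply]

/-- The number operator: contracting with a frame and wedging back counts the degree. -/
theorem IsOrthonormalFrame.sum_wedgeLM_curryLeft (h : IsOrthonormalFrame ε e B) {ℓ : ℕ}
    (w : T [⋀^Fin (ℓ + 1)]→ₗ[ℝ] 𝕜) :
    ∑ a, sgn (ε a) • wedgeLM 𝕜 B ℓ (e a) (w.curryLeft (e a)) = ((ℓ : ℝ) + 1) • w := by
  rw [h.sum_wedgeLM, alternatizeUncurryFin_curryLeft, ← Nat.cast_smul_eq_nsmul ℝ]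
  push_cast
  rfl

theorem IsOrthonormalFrame.sum_norm (h : IsOrthonormalFrame ε e B) :
    ∑ a, sgn (ε a) * B (e a) (e a) = n := by
  simp [h.norm, sgn_mul_self]

/-- The metric trace of `X ↦ X ∧ w`. -/
theorem IsOrthonormalFrame.formTrace_wedgeLM (h : IsOrthonormalFrame ε e B) {ℓ : ℕ}
    (w : T [⋀^Fin ℓ]→ₗ[ℝ] 𝕜) :
    formTrace ε e (ℓ + 1) ((wedgeLM 𝕜 B ℓ).flip w) = ((n : ℝ) - ℓ) • w := by
  rw [formTrace_succ]
  cases ℓ with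
  | zero =>
    simp only [LinearMap.flip_apply, curryLeft_wedgeLM_zero, smul_smul]
    rw [← Finset.sum_smul, h.sum_norm]
    simp
  | succ ℓ =>
    simp only [LinearMap.flip_apply, curryLeft_wedgeLM, smul_sub, smul_smul]
    rw [Finset.sum_sub_distrib, h.sum_wedgeLM_curryLeft, ← Finset.sum_smul, h.sum_norm,
      ← sub_smul]
    push_cast
    rfl

/-- If `X ∧ α(X) = 0` for all `X`, then `α` is determined by its metric trace. -/
theorem IsOrthonormalFrame.eq_wedge_of_wedge_eq_zero (h : IsOrthonormalFrame ε e B) {ℓ : ℕ}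
    {α : T →ₗ[ℝ] T [⋀^Fin ℓ]→ₗ[ℝ] 𝕜} (hα : ∀ X, wedgeLM 𝕜 B ℓ X (α X) = 0) (Z : T) :
    ((n : ℝ) - ℓ + 1) • α Z = wedge B ℓ Z (formTrace ε e ℓ α) := by
  have hpol : ∀ X Z, wedgeLM 𝕜 B ℓ Z (α X) + wedgeLM 𝕜 B ℓ X (α Z) = 0 := by
    intro X Z
    have := hα (X + Z)
    simp only [map_add, LinearMap.add_apply, hα, zero_add, add_zero] at this
    rw [← this]
  -- Contracting the polarized identity with `e a` and summing gives
  -- $\alpha(Z)-Z\wedge\operatorname{tr}\alpha+n\,\alpha(Z)-\ell\,\alpha(Z)=0$; the last term is the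
  -- number operator on $\alpha(Z)$.
  have hsum : ∑ a, sgn (ε a) • (wedgeLM 𝕜 B ℓ Z (α (e a)) +
      wedgeLM 𝕜 B ℓ (e a) (α Z)).curryLeft (e a) = 0 := by
    simp [hpol]
  have hn := h.sum_norm
  cases ℓ with
  | zero =>
    simp only [curryLeft_add, LinearMap.add_apply, curryLeft_wedgeLM_zero, smul_add, smul_smul,
      Finset.sum_add_distrib] at hsum
    rw [← Finset.sum_smul, hn] at hsum
    have h2 : ∑ a, (sgn (ε a) * B Z (e a)) • α (e a) = α Z := by
      simpa [h.symm Z] using h.sum_smul_map α Z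
    rw [h2] at hsum
    simp only [wedge, CharP.cast_eq_zero, sub_zero, add_smul, one_smul]
    rw [add_comm, hsum]
  | succ ℓ =>
    simp only [curryLeft_add, LinearMap.add_apply, curryLeft_wedgeLM, smul_add, smul_smul,
      smul_sub, Finset.sum_add_distrib, Finset.sum_sub_distrib] at hsum
    rw [← Finset.sum_smul, hn, h.sum_wedgeLM_curryLeft] at hsum
    have h2 : ∑ a, (sgn (ε a) * B Z (e a)) • α (e a) = α Z := by
      simpa [h.symm Z] using h.sum_smul_map α Z
    rw [h2] at hsum
    have h3 : ∑ a, sgn (ε a) • wedgeLM 𝕜 B ℓ Z ((α (e a)).curryLeft (e a)) =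
        wedge B (ℓ + 1) Z (formTrace ε e (ℓ + 1) α) := by
      rw [wedge_succ, formTrace_succ]
      simp
    rw [h3] at hsum
    rw [← sub_eq_zero, ← hsum]
    push_cast
    module

/-- If `X ⌟ α(X) = 0` for all `X`, then `α` is determined by its skew symmetrization. -/
theorem eq_curryLeft_of_contract_eq_zero {ℓ : ℕ} {α : T →ₗ[ℝ] T [⋀^Fin ℓ]→ₗ[ℝ] 𝕜}
    (hα : ∀ X, contract X (α X) = 0) (Z : T) :
    ((ℓ : ℝ) + 1) • α Z = (alternatizeUncurryFin α).curryLeft Z := by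
  have hpol : ∀ X Z, contract Z (α X) = -contract X (α Z) := by
    intro X Z
    have := hα (X + Z)
    simp only [map_add, contract_add_left, contract_add_right, hα, zero_add, add_zero] at this
    exact eq_neg_of_add_eq_zero_left this
  cases ℓ with
  | zero => rw [curryLeft_alternatizeUncurryFin_zero]; simp
  | succ ℓ =>
    -- By polarization $Z\rfloor\alpha(X)=-X\rfloor\alpha(Z)$, whose alternation in $X$ is minus the
    -- degree times $\alpha(Z)$. The Leibniz rule then adds this degree to the leading $\alpha(Z)$.
    have h1 : (contractLM 𝕜 T (ℓ + 1) Z ∘ₗ α : T →ₗ[ℝ] T [⋀^Fin ℓ]→ₗ[ℝ] 𝕜) =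
        -(α Z).curryLeft := by
      ext1 X
      exact hpol X Z
    rw [curryLeft_alternatizeUncurryFin, h1, ← neg_one_smul ℝ, alternatizeUncurryFin_smul,
      alternatizeUncurryFin_curryLeft, ← Nat.cast_smul_eq_nsmul ℝ]
    push_cast
    module

/-- `X ↦ X ∧ G` as a linear map, `G` being a form of degree `ℓ - 1`. -/
def wedgeMap (B : T →ₗ[ℝ] T →ₗ[ℝ] ℝ) :
    (ℓ : ℕ) → (T [⋀^Fin (ℓ - 1)]→ₗ[ℝ] 𝕜) → (T →ₗ[ℝ] T [⋀^Fin ℓ]→ₗ[ℝ] 𝕜)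
  | 0, _ => 0
  | ℓ + 1, G => (wedgeLM 𝕜 B ℓ).flip G

theorem wedgeMap_apply (B : T →ₗ[ℝ] T →ₗ[ℝ] ℝ) (ℓ : ℕ) (G : T [⋀^Fin (ℓ - 1)]→ₗ[ℝ] 𝕜) (X : T) :
    wedgeMap B ℓ G X = wedge B ℓ X G := by
  cases ℓ <;> rfl

theorem wedgeMap_smul (B : T →ₗ[ℝ] T →ₗ[ℝ] ℝ) (ℓ : ℕ) (r : ℝ) (G : T [⋀^Fin (ℓ - 1)]→ₗ[ℝ] 𝕜) :
    wedgeMap B ℓ (r • G) = r • wedgeMap B ℓ G := by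
  cases ℓ <;> simp [wedgeMap]

theorem wedgeMap_zero (B : T →ₗ[ℝ] T →ₗ[ℝ] ℝ) (ℓ : ℕ) :
    wedgeMap B ℓ (0 : T [⋀^Fin (ℓ - 1)]→ₗ[ℝ] 𝕜) = 0 := by
  cases ℓ <;> simp [wedgeMap]

theorem IsOrthonormalFrame.alternatizeUncurryFin_wedgeMap (h : IsOrthonormalFrame ε e B) {ℓ : ℕ}
    (G : T [⋀^Fin (ℓ - 1)]→ₗ[ℝ] 𝕜) : alternatizeUncurryFin (wedgeMap B ℓ G) = 0 := by
  cases ℓ with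
  | zero => exact alternatizeUncurryFinLM.map_zero
  | succ ℓ => exact alternatizeUncurryFin_wedgeLM h.symm G

theorem IsOrthonormalFrame.formTrace_wedgeMap (h : IsOrthonormalFrame ε e B) {ℓ : ℕ}
    {G : T [⋀^Fin (ℓ - 1)]→ₗ[ℝ] 𝕜} (hG : ℓ = 0 → G = 0) :
    formTrace ε e ℓ (wedgeMap B ℓ G) = ((n : ℝ) - ℓ + 1) • G := by
  cases ℓ with
  | zero => rw [hG rfl, smul_zero]; rfl
  | succ ℓ =>
    rw [wedgeMap, h.formTrace_wedgeLM]
    push_cast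
    ring_nf

/-- The skew symmetrization of `X ↦ X ⌟ F + X ∧ G + A₀(X)`. -/
theorem IsOrthonormalFrame.alternatizeUncurryFin_decomposition (h : IsOrthonormalFrame ε e B)
    {ℓ : ℕ} {α A₀ : T →ₗ[ℝ] T [⋀^Fin ℓ]→ₗ[ℝ] 𝕜} {F : T [⋀^Fin (ℓ + 1)]→ₗ[ℝ] 𝕜}
    {G : T [⋀^Fin (ℓ - 1)]→ₗ[ℝ] 𝕜} (hα : α = F.curryLeft + wedgeMap B ℓ G + A₀)
    (hA : alternatizeUncurryFin A₀ = 0) :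
    alternatizeUncurryFin α = ((ℓ : ℝ) + 1) • F := by
  rw [hα, alternatizeUncurryFin_add, alternatizeUncurryFin_add, hA,
    h.alternatizeUncurryFin_wedgeMap, alternatizeUncurryFin_curryLeft,
    ← Nat.cast_smul_eq_nsmul ℝ]
  simp

/-- The metric trace of `X ↦ X ⌟ F + X ∧ G + A₀(X)`. -/
theorem IsOrthonormalFrame.formTrace_decomposition (h : IsOrthonormalFrame ε e B)
    {ℓ : ℕ} {α A₀ : T →ₗ[ℝ] T [⋀^Fin ℓ]→ₗ[ℝ] 𝕜} {F : T [⋀^Fin (ℓ + 1)]→ₗ[ℝ] 𝕜}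
    {G : T [⋀^Fin (ℓ - 1)]→ₗ[ℝ] 𝕜} (hα : α = F.curryLeft + wedgeMap B ℓ G + A₀)
    (hG : ℓ = 0 → G = 0) (hA : formTrace ε e ℓ A₀ = 0) :
    formTrace ε e ℓ α = ((n : ℝ) - ℓ + 1) • G := by
  rw [hα, formTrace_add, formTrace_add, hA, h.formTrace_wedgeMap hG, formTrace_curryLeft]
  simp

end Trace

end

/-! ### Clifford action of forms -/

section

open AlternatingMap (curryLeft_apply_apply)

section CliffordAction

variable {𝕜 : Type*} [RCLike 𝕜] {T : Type*} [AddCommGroup T] [Module ℝ T]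
  {S : Type*} [AddCommGroup S] [Module ℝ S] [Module 𝕜 S] [IsScalarTower ℝ 𝕜 S]
  {n : ℕ} {ε : Fin n → ℤˣ} {e : Fin n → T} {B : T →ₗ[ℝ] T →ₗ[ℝ] ℝ}
  {γ : T →ₗ[ℝ] Module.End 𝕜 S}

/-- The action of forms on spinors as a linear map. -/
def cliffordLM (ε : Fin n → ℤˣ) (e : Fin n → T) (γ : T →ₗ[ℝ] Module.End 𝕜 S) (ℓ : ℕ) :
    (T [⋀^Fin ℓ]→ₗ[ℝ] 𝕜) →ₗ[ℝ] Module.End 𝕜 S where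
  toFun w := cliffordOfForm ε e γ w
  map_add' v w := by
    simp [cliffordOfForm, mul_add, add_smul, Finset.sum_add_distrib]
  map_smul' r w := by
    simp only [cliffordOfForm, AlternatingMap.smul_apply, RingHom.id_apply]
    rw [smul_comm r ((ℓ.factorial : 𝕜)⁻¹)]
    refine congrArg _ ?_
    rw [Finset.smul_sum]
    refine Finset.sum_congr rfl fun I _ => ?_
    rw [mul_smul_comm, smul_assoc]

theorem cliffordLM_zero (w : T [⋀^Fin 0]→ₗ[ℝ] 𝕜) :
    cliffordLM ε e γ 0 w = w ![] • (1 : Module.End 𝕜 S) := by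
  simp [cliffordLM, cliffordOfForm]
  congr 2
  exact Subsingleton.elim _ _

/-- Splitting the first index off the multi-index sum gives a recursion on the degree, on which the
inductions below rest. The factor $\ell+1$ accounts for the quotient of the factorials. -/
theorem cliffordLM_succ {ℓ : ℕ} (w : T [⋀^Fin (ℓ + 1)]→ₗ[ℝ] 𝕜) :
    ((ℓ : ℝ) + 1) • cliffordLM ε e γ (ℓ + 1) w =
      ∑ a, sgn (ε a) • (γ (e a) * cliffordLM ε e γ ℓ (w.curryLeft (e a))) := by
  simp only [cliffordLM, LinearMap.coe_mk, AddHom.coe_mk, cliffordOfForm]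
  rw [← (Fin.consEquiv fun _ => Fin n).sum_comp, Fintype.sum_prod_type]
  have hfac : ((ℓ : ℝ) + 1) • ((((ℓ + 1).factorial : 𝕜)⁻¹)) = ((ℓ.factorial : 𝕜)⁻¹) := by
    rw [Nat.factorial_succ, Algebra.smul_def]
    have h1 : ((ℓ : 𝕜) + 1) ≠ 0 := Nat.cast_add_one_ne_zero ℓ
    push_cast
    rw [mul_inv, ← mul_assoc, mul_inv_cancel₀ h1, one_mul]
  rw [← smul_assoc, hfac, Finset.smul_sum]
  refine Finset.sum_congr rfl fun a _ => ?_
  rw [mul_smul_comm, smul_comm (sgn (ε a))]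
  congr 1
  rw [Finset.mul_sum, Finset.smul_sum]
  refine Finset.sum_congr rfl fun J _ => ?_
  rw [mul_smul_comm, ← smul_assoc]
  congr 1
  · simp only [Fin.consEquiv_apply, Fin.prod_univ_succ, Fin.cons_zero, Fin.cons_succ,
      curryLeft_apply_apply]
    rw [Algebra.smul_def]
    push_cast
    rw [mul_assoc]
    congr 3
    ext j
    refine Fin.cases ?_ (fun j => ?_) j <;> simp
  · simp [List.ofFn_succ]

/-- The recursion in a form uniform in the degree: for $\ell=0$ both sides vanish. -/
theorem smul_cliffordLM (ℓ : ℕ) (w : T [⋀^Fin ℓ]→ₗ[ℝ] 𝕜) :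
    (ℓ : ℝ) • cliffordLM ε e γ ℓ w =
      ∑ a, sgn (ε a) • (γ (e a) * cliffordLM ε e γ (ℓ - 1) (contract (e a) w)) := by
  cases ℓ with
  | zero => simp
  | succ ℓ =>
    push_cast
    exact cliffordLM_succ w

variable (h : IsOrthonormalFrame ε e B)
  (hγ : ∀ X Y, γ X * γ Y + γ Y * γ X = (-2 * B X Y) • (1 : Module.End 𝕜 S))

include h hγ in
/-- `Z · w - (-1)^ℓ w · Z = -2 Z ⌟ w`. -/
theorem clifford_commutator : ∀ (ℓ : ℕ) (w : T [⋀^Fin ℓ]→ₗ[ℝ] 𝕜) (Z : T),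
    γ Z * cliffordLM ε e γ ℓ w - (-1 : ℝ) ^ ℓ • (cliffordLM ε e γ ℓ w * γ Z) =
      (-2 : ℝ) • cliffordLM ε e γ (ℓ - 1) (contract Z w)
  | 0, w, Z => by
    simp [cliffordLM_zero]
  | ℓ + 1, w, Z => by
    have ih := fun a => clifford_commutator ℓ (w.curryLeft (e a)) Z
    have hℓ : (ℓ : ℝ) + 1 ≠ 0 := Nat.cast_add_one_ne_zero ℓ
    -- Anticommuting `Z` past `e a` leaves $-2\,Z\rfloor w$ in total. Moving it on past $e_a\rfloor
    -- w$ by induction leaves double contractions, which sum to $-2\ell\,Z\rfloor w$. Together this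
    -- is $\ell+1$ times the claimed commutator.
    have h1 : ∑ a, sgn (ε a) • (γ Z * (γ (e a) * cliffordLM ε e γ ℓ (w.curryLeft (e a)))) =
        (-2 : ℝ) • cliffordLM ε e γ ℓ (w.curryLeft Z) +
        (-1 : ℝ) ^ (ℓ + 1) •
          ∑ a, sgn (ε a) • (γ (e a) * cliffordLM ε e γ ℓ (w.curryLeft (e a)) * γ Z) -
        (2 * ℓ : ℝ) • cliffordLM ε e γ ℓ (w.curryLeft Z) := by
      have h2 : (2 * ℓ : ℝ) • cliffordLM ε e γ ℓ (w.curryLeft Z) =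
          - ∑ a, sgn (ε a) • (2 : ℝ) • (γ (e a) *
            cliffordLM ε e γ (ℓ - 1) (contract Z (w.curryLeft (e a)))) := by
        rw [mul_smul, smul_cliffordLM, Finset.smul_sum, ← Finset.sum_neg_distrib]
        refine Finset.sum_congr rfl fun a _ => ?_
        have h3 : contract (e a) (w.curryLeft Z) = -contract Z (w.curryLeft (e a)) :=
          contract_contract (e a) Z w
        rw [h3, map_neg, mul_neg, smul_neg, smul_neg, smul_comm (2 : ℝ)]
      have h4 : cliffordLM ε e γ ℓ (w.curryLeft Z) =
          ∑ a, (sgn (ε a) * B (e a) Z) • cliffordLM ε e γ ℓ (w.curryLeft (e a)) :=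
        (h.sum_smul_map (cliffordLM ε e γ ℓ ∘ₗ w.curryLeft) Z).symm
      rw [h2, sub_neg_eq_add]
      conv_rhs => rw [h4]
      rw [Finset.smul_sum, Finset.smul_sum, ← Finset.sum_add_distrib, ← Finset.sum_add_distrib]
      refine Finset.sum_congr rfl fun a _ => ?_
      have h5 : γ Z * γ (e a) = (-2 * B (e a) Z) • (1 : Module.End 𝕜 S) - γ (e a) * γ Z := by
        rw [← hγ (e a) Z]; abel
      rw [← mul_assoc, h5, sub_mul, smul_mul_assoc, one_mul, mul_assoc,
        eq_add_of_sub_eq (ih a), mul_add, mul_smul_comm, mul_smul_comm, mul_assoc]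
      module
    have h6 := cliffordLM_succ (ε := ε) (e := e) (γ := γ) w
    have h7 : ((ℓ : ℝ) + 1) • (γ Z * cliffordLM ε e γ (ℓ + 1) w) =
        ∑ a, sgn (ε a) • (γ Z * (γ (e a) * cliffordLM ε e γ ℓ (w.curryLeft (e a)))) := by
      rw [← mul_smul_comm, h6, Finset.mul_sum]
      exact Finset.sum_congr rfl fun a _ => mul_smul_comm _ _ _
    have h8 : ((ℓ : ℝ) + 1) • (cliffordLM ε e γ (ℓ + 1) w * γ Z) =
        ∑ a, sgn (ε a) • (γ (e a) * cliffordLM ε e γ ℓ (w.curryLeft (e a)) * γ Z) := by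
      rw [← smul_mul_assoc, h6, Finset.sum_mul]
      exact Finset.sum_congr rfl fun a _ => smul_mul_assoc _ _ _
    rw [← h7, ← h8] at h1
    refine smul_right_injective _ hℓ ?_
    change ((ℓ : ℝ) + 1) • _ = ((ℓ : ℝ) + 1) • _
    rw [smul_sub, h1, contract_succ, smul_comm ((ℓ : ℝ) + 1) ((-1 : ℝ) ^ (ℓ + 1))]
    change _ = ((ℓ : ℝ) + 1) • (-2 : ℝ) • cliffordLM ε e γ ℓ (w.curryLeft Z)
    module

include h hγ in
/-- `Z · w = Z ∧ w - Z ⌟ w`. -/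
theorem clifford_mul : ∀ (ℓ : ℕ) (w : T [⋀^Fin ℓ]→ₗ[ℝ] 𝕜) (Z : T),
    γ Z * cliffordLM ε e γ ℓ w =
      cliffordLM ε e γ (ℓ + 1) (wedgeLM 𝕜 B ℓ Z w) - cliffordLM ε e γ (ℓ - 1) (contract Z w)
  | 0, w, Z => by
    have h1 := cliffordLM_succ (ε := ε) (e := e) (γ := γ) (wedgeLM 𝕜 B 0 Z w)
    simp only [curryLeft_wedgeLM_zero, map_smul] at h1
    have h2 := congrArg (· * cliffordLM ε e γ 0 w) (h.sum_smul_map γ Z)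
    simp only [Finset.sum_mul] at h2
    simp only [contract_of_degree_zero, map_zero, sub_zero]
    rw [← h2]
    simp only [CharP.cast_eq_zero, zero_add, one_smul] at h1
    rw [h1]
    refine Finset.sum_congr rfl fun a _ => ?_
    rw [mul_smul_comm, smul_mul_assoc, h.symm Z, smul_smul]
  | ℓ + 1, w, Z => by
    have ih := fun a => clifford_mul ℓ (w.curryLeft (e a)) Z
    have hℓ : (ℓ : ℝ) + 1 + 1 ≠ 0 := by positivity
    have h1 := cliffordLM_succ (ε := ε) (e := e) (γ := γ) (wedgeLM 𝕜 B (ℓ + 1) Z w)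
    have h2 := congrArg (· * cliffordLM ε e γ (ℓ + 1) w) (h.sum_smul_map γ Z)
    simp only [Finset.sum_mul] at h2
    have h4 : cliffordLM ε e γ ℓ (w.curryLeft Z) =
          ∑ a, (sgn (ε a) * B (e a) Z) • cliffordLM ε e γ ℓ (w.curryLeft (e a)) :=
        (h.sum_smul_map (cliffordLM ε e γ ℓ ∘ₗ w.curryLeft) Z).symm
    have h3 : (ℓ : ℝ) • cliffordLM ε e γ ℓ (w.curryLeft Z) =
          - ∑ a, sgn (ε a) • (γ (e a) *
            cliffordLM ε e γ (ℓ - 1) (contract Z (w.curryLeft (e a)))) := by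
      rw [smul_cliffordLM, ← Finset.sum_neg_distrib]
      refine Finset.sum_congr rfl fun a _ => ?_
      have h3 : contract (e a) (w.curryLeft Z) = -contract Z (w.curryLeft (e a)) :=
        contract_contract (e a) Z w
      rw [h3, map_neg, mul_neg, smul_neg]
    have h7 : ((ℓ : ℝ) + 1) • (γ Z * cliffordLM ε e γ (ℓ + 1) w) =
        ∑ a, sgn (ε a) • (γ Z * (γ (e a) * cliffordLM ε e γ ℓ (w.curryLeft (e a)))) := by
      rw [← mul_smul_comm, cliffordLM_succ w, Finset.mul_sum]
      exact Finset.sum_congr rfl fun a _ => mul_smul_comm _ _ _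
    -- In $e_a\rfloor(Z\wedge w)=\langle Z,e_a\rangle w-Z\wedge(e_a\rfloor w)$ the last term is
    -- rewritten by the induction hypothesis, and `Z` is moved to the left of `e a`. Summing over
    -- `a` yields $\ell+2$ times $Z\cdot w+Z\rfloor w$.
    have key : ∀ a, sgn (ε a) • (γ (e a) *
          cliffordLM ε e γ (ℓ + 1) ((wedgeLM 𝕜 B (ℓ + 1) Z w).curryLeft (e a))) =
        (sgn (ε a) * B (e a) Z) • γ (e a) * cliffordLM ε e γ (ℓ + 1) w +
        sgn (ε a) • (γ Z * (γ (e a) * cliffordLM ε e γ ℓ (w.curryLeft (e a)))) +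
        (2 : ℝ) • (sgn (ε a) * B (e a) Z) • cliffordLM ε e γ ℓ (w.curryLeft (e a)) -
        sgn (ε a) • (γ (e a) *
            cliffordLM ε e γ (ℓ - 1) (contract Z (w.curryLeft (e a)))) := by
      intro a
      have h5 : γ Z * γ (e a) = (-2 * B (e a) Z) • (1 : Module.End 𝕜 S) - γ (e a) * γ Z := by
        rw [← hγ (e a) Z]; abel
      rw [curryLeft_wedgeLM, map_sub, map_smul, eq_add_of_sub_eq (ih a).symm,
        ← mul_assoc (γ Z), h5, h.symm Z]
      simp only [mul_sub, mul_add, sub_mul, smul_mul_assoc, mul_smul_comm, one_mul, mul_assoc]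
      module
    simp only [key, Finset.sum_sub_distrib, Finset.sum_add_distrib, ← Finset.smul_sum, h2, ← h4,
      ← h7] at h1
    refine smul_right_injective _ hℓ ?_
    change ((ℓ : ℝ) + 1 + 1) • _ = ((ℓ : ℝ) + 1 + 1) • _
    push_cast at h1
    rw [smul_sub, h1, contract_succ, sub_eq_add_neg _ (∑ a, _), ← h3]
    change _ = _ - ((ℓ : ℝ) + 1 + 1) • cliffordLM ε e γ ℓ (w.curryLeft Z)
    module

include h hγ in
/-- `w · Z = (-1)^ℓ (Z ∧ w + Z ⌟ w)`. -/
theorem clifford_mul_right (ℓ : ℕ) (w : T [⋀^Fin ℓ]→ₗ[ℝ] 𝕜) (Z : T) :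
    cliffordLM ε e γ ℓ w * γ Z = (-1 : ℝ) ^ ℓ •
      (cliffordLM ε e γ (ℓ + 1) (wedgeLM 𝕜 B ℓ Z w) +
        cliffordLM ε e γ (ℓ - 1) (contract Z w)) := by
  have h1 := clifford_commutator h hγ ℓ w Z
  rw [clifford_mul h hγ, sub_eq_iff_eq_add, ← sub_eq_iff_eq_add'] at h1
  have h2 : (-1 : ℝ) ^ ℓ * (-1 : ℝ) ^ ℓ = 1 := by rw [← mul_pow]; simp
  have h3 : cliffordLM ε e γ ℓ w * γ Z =
      (-1 : ℝ) ^ ℓ • (-1 : ℝ) ^ ℓ • (cliffordLM ε e γ ℓ w * γ Z) := by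
    rw [smul_smul, h2, one_smul]
  rw [h3, ← h1]
  congr 1
  module

include h hγ in
/-- Forms of a fixed degree act faithfully on spinors. -/
theorem cliffordLM_injective [Nontrivial S] : ∀ (ℓ : ℕ) (w : T [⋀^Fin ℓ]→ₗ[ℝ] 𝕜),
    cliffordLM ε e γ ℓ w = 0 → w = 0
  | 0, w, hw => by
    rw [cliffordLM_zero, smul_eq_zero] at hw
    ext v
    rw [Subsingleton.elim v ![], hw.resolve_right one_ne_zero]
    rfl
  | ℓ + 1, w, hw => by
    -- If $w$ acts as zero, so does its graded commutator with $Z$, which is $-2\,Z\rfloor w$. The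
    -- degree thus descends to 0, where forms act as scalars on a nonzero space.
    have h1 : ∀ Z, w.curryLeft Z = 0 := by
      intro Z
      have h2 := clifford_commutator h hγ (ℓ + 1) w Z
      rw [hw] at h2
      simp only [mul_zero, zero_mul, smul_zero, sub_zero, contract_succ] at h2
      exact cliffordLM_injective ℓ _ ((smul_eq_zero.1 h2.symm).resolve_left (by norm_num))
    ext v
    have h2 := congrArg (fun u => u (Matrix.vecTail v)) (h1 (Matrix.vecHead v))
    simpa [curryLeft_apply_apply, Matrix.cons_head_tail] using h2

include h hγ in
/-- `∑ ε_a (e_a ⌟ w) · e_a`. -/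
theorem sum_clifford_mul_right {ℓ : ℕ} (w : T [⋀^Fin (ℓ + 1)]→ₗ[ℝ] 𝕜) :
    ∑ a, sgn (ε a) • (cliffordLM ε e γ ℓ (w.curryLeft (e a)) * γ (e a)) =
      ((-1 : ℝ) ^ ℓ * ((ℓ : ℝ) + 1)) • cliffordLM ε e γ (ℓ + 1) w := by
  rw [mul_smul, cliffordLM_succ, Finset.smul_sum]
  refine Finset.sum_congr rfl fun a _ => ?_
  -- The form $e_a\rfloor w$ has no further contraction with `e a`, so `e a` passes through it with
  -- the sign $(-1)^\ell$ only.
  have h1 := clifford_commutator h hγ ℓ (w.curryLeft (e a)) (e a)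
  have h0 : contract (e a) (w.curryLeft (e a)) = 0 := contract_contract_self (e a) w
  rw [h0, map_zero, smul_zero, sub_eq_zero] at h1
  rw [h1, smul_comm (sgn (ε a)), smul_smul, ← mul_pow]
  simp

/-- The sign with which the charge adjoint acts on forms of degree `ℓ`. -/
def adjointSign (s : ℝ) (ℓ : ℕ) : ℝ := s ^ ℓ * (-1) ^ (ℓ * (ℓ - 1) / 2)

theorem adjointSign_succ (s : ℝ) (ℓ : ℕ) :
    adjointSign s (ℓ + 1) = s * (-1) ^ ℓ * adjointSign s ℓ := by
  have h1 : (ℓ + 1) * (ℓ + 1 - 1) / 2 = ℓ + ℓ * (ℓ - 1) / 2 := by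
    have := Nat.triangle_succ ℓ
    omega
  rw [adjointSign, adjointSign, h1]
  ring

include h hγ in
/-- The charge adjoint of the action of a form. -/
theorem form_cliffordLM {b : LinearMap.BilinForm 𝕜 S} {s : ℝ}
    (hb : ∀ X φ ψ, b φ (γ X ψ) = s • b (γ X φ) ψ) : ∀ (ℓ : ℕ) (w : T [⋀^Fin ℓ]→ₗ[ℝ] 𝕜) (φ ψ : S),
      b φ (cliffordLM ε e γ ℓ w ψ) = adjointSign s ℓ • b (cliffordLM ε e γ ℓ w φ) ψ
  | 0, w, φ, ψ => by
    simp [cliffordLM_zero, adjointSign]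
  | ℓ + 1, w, φ, ψ => by
    have hsm : ∀ (r : ℝ) (x y : S), b x (r • y) = r • b x y := by
      intro r x y
      rw [← algebraMap_smul 𝕜 r y, map_smul, algebraMap_smul]
    have hsm' : ∀ (r : ℝ) (x y : S), b (r • x) y = r • b x y := by
      intro r x y
      rw [← algebraMap_smul 𝕜 r x, map_smul, LinearMap.smul_apply, algebraMap_smul]
    have hℓ : (ℓ : ℝ) + 1 ≠ 0 := Nat.cast_add_one_ne_zero ℓ
    -- Taking the adjoint of $e_a\cdot(e_a\rfloor w)$ reverses the factors; `sum_clifford_mul_right`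
    -- restores their order at the cost of $(-1)^\ell$, which is the recursion of `adjointSign`.
    have h1 := congrArg (fun Φ : Module.End 𝕜 S => b φ (Φ ψ))
      (cliffordLM_succ (ε := ε) (e := e) (γ := γ) w)
    have h2 := congrArg (fun Φ : Module.End 𝕜 S => b (Φ φ) ψ) (sum_clifford_mul_right h hγ w)
    simp only [LinearMap.smul_apply, LinearMap.sum_apply, map_sum, hsm, hsm', Module.End.mul_apply,
      hb, form_cliffordLM hb ℓ] at h1 h2
    refine smul_right_injective _ hℓ ?_
    change ((ℓ : ℝ) + 1) • _ = ((ℓ : ℝ) + 1) • _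
    rw [h1, adjointSign_succ]
    have h3 : ((ℓ : ℝ) + 1) • (s * (-1) ^ ℓ * adjointSign s ℓ) •
        b (cliffordLM ε e γ (ℓ + 1) w φ) ψ = (s * adjointSign s ℓ) •
          ((-1 : ℝ) ^ ℓ * ((ℓ : ℝ) + 1)) • b (cliffordLM ε e γ (ℓ + 1) w φ) ψ := by
      module
    rw [h3, ← h2, Finset.smul_sum]
    refine Finset.sum_congr rfl fun a _ => ?_
    module

end CliffordAction

end

/-! ### Decomposition and the pointwise criterion -/

section

open AlternatingMap (alternatizeUncurryFin alternatizeUncurryFinLM alternatizeUncurryFin_add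
  alternatizeUncurryFin_smul alternatizeUncurryFin_curryLeft
  alternatizeUncurryFin_alternatizeUncurryFinLM_comp_of_symmetric)

section Decomposition

variable {𝕜 : Type*} [RCLike 𝕜] {T : Type*} [AddCommGroup T] [Module ℝ T]
  {n : ℕ} {ε : Fin n → ℤˣ} {e : Fin n → T} {B : T →ₗ[ℝ] T →ₗ[ℝ] ℝ}

/-- The twofold exterior product is the double alternation of a tensor symmetric in its first two
arguments. -/
theorem wedgeLM_wedgeLM_self (B : T →ₗ[ℝ] T →ₗ[ℝ] ℝ) {ℓ : ℕ} (Z : T)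
    (w : T [⋀^Fin ℓ]→ₗ[ℝ] 𝕜) : wedgeLM 𝕜 B (ℓ + 1) Z (wedgeLM 𝕜 B ℓ Z w) = 0 := by
  let f : T →ₗ[ℝ] T →ₗ[ℝ] T [⋀^Fin ℓ]→ₗ[ℝ] 𝕜 :=
    LinearMap.mk₂ ℝ (fun X Y => (B Z X * B Z Y) • w) (by simp [add_mul, add_smul])
      (by simp [mul_smul]) (by simp [mul_add, add_smul])
      (by intros; simp only [map_smul, smul_eq_mul, smul_smul]; ring_nf)
  have hf : (B Z).smulRight (wedgeLM 𝕜 B ℓ Z w) = alternatizeUncurryFinLM ∘ₗ f := by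
    ext1 X
    have h1 : f X = B Z X • (B Z).smulRight w := by
      ext1 Y
      simp [f, mul_smul]
    rw [LinearMap.comp_apply, h1, map_smul]
    rfl
  rw [wedgeLM_apply, hf]
  exact alternatizeUncurryFin_alternatizeUncurryFinLM_comp_of_symmetric fun X Y => by
    simp [f, mul_comm]

theorem cast_sub_cast_add_one_ne_zero {ℓ n : ℕ} (hℓ : ℓ ≤ n) : (n : ℝ) - ℓ + 1 ≠ 0 := by
  have : (ℓ : ℝ) ≤ n := by exact_mod_cast hℓ
  intro h
  linarith

variable (h : IsOrthonormalFrame ε e B)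

include h in
/-- Every one-form with values in `ℓ`-forms decomposes as `X ↦ X ⌟ F + X ∧ G + A₀(X)`. -/
theorem IsOrthonormalFrame.exists_decomposition {ℓ : ℕ} (hℓ : ℓ ≤ n)
    (α : T →ₗ[ℝ] T [⋀^Fin ℓ]→ₗ[ℝ] 𝕜) :
    ∃ (F : T [⋀^Fin (ℓ + 1)]→ₗ[ℝ] 𝕜) (G : T [⋀^Fin (ℓ - 1)]→ₗ[ℝ] 𝕜)
      (A₀ : T →ₗ[ℝ] T [⋀^Fin ℓ]→ₗ[ℝ] 𝕜), (ℓ = 0 → G = 0) ∧ alternatizeUncurryFin A₀ = 0 ∧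
        formTrace ε e ℓ A₀ = 0 ∧ α = F.curryLeft + wedgeMap B ℓ G + A₀ := by
  have h1 : (ℓ : ℝ) + 1 ≠ 0 := Nat.cast_add_one_ne_zero ℓ
  have h2 := cast_sub_cast_add_one_ne_zero hℓ
  -- The constants invert the factors by which alternation acts on $X\rfloor F$ and the trace on
  -- $X\wedge G$; the remainder then has neither alternation nor trace.
  set F := ((ℓ : ℝ) + 1)⁻¹ • alternatizeUncurryFin α with hF
  set G := ((n : ℝ) - ℓ + 1)⁻¹ • formTrace ε e ℓ α with hG
  have hG0 : ℓ = 0 → G = 0 := by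
    rintro rfl
    rw [hG, formTrace, smul_zero]
  have hα : α = F.curryLeft + wedgeMap B ℓ G + (α - F.curryLeft - wedgeMap B ℓ G) := by abel
  refine ⟨F, G, _, hG0, ?_, ?_, hα⟩
  · have h3 := congrArg alternatizeUncurryFin hα
    rw [alternatizeUncurryFin_add, alternatizeUncurryFin_add, h.alternatizeUncurryFin_wedgeMap,
      alternatizeUncurryFin_curryLeft, ← Nat.cast_smul_eq_nsmul ℝ, add_zero] at h3
    have h4 : ((ℓ + 1 : ℕ) : ℝ) • F = alternatizeUncurryFin α := by
      rw [hF, smul_smul]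
      push_cast
      rw [mul_inv_cancel₀ h1, one_smul]
    rw [h4] at h3
    exact left_eq_add.1 h3
  · have h3 := congrArg (formTrace ε e ℓ) hα
    rw [formTrace_add, formTrace_add, formTrace_curryLeft, h.formTrace_wedgeMap hG0, zero_add, hG,
      smul_smul, mul_inv_cancel₀ h2, one_smul] at h3
    exact left_eq_add.1 h3

include h in
-- Alternation recovers $F$ and the trace recovers $G$, each up to a nonzero factor; $\ell\le n$
-- ensures this for the trace.
theorem IsOrthonormalFrame.decomposition_unique {ℓ : ℕ} (hℓ : ℓ ≤ n)
    {F F' : T [⋀^Fin (ℓ + 1)]→ₗ[ℝ] 𝕜} {G G' : T [⋀^Fin (ℓ - 1)]→ₗ[ℝ] 𝕜}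
    {A₀ A₀' : T →ₗ[ℝ] T [⋀^Fin ℓ]→ₗ[ℝ] 𝕜} (hG : ℓ = 0 → G = 0) (hG' : ℓ = 0 → G' = 0)
    (hA : alternatizeUncurryFin A₀ = 0) (hA' : alternatizeUncurryFin A₀' = 0)
    (hT : formTrace ε e ℓ A₀ = 0) (hT' : formTrace ε e ℓ A₀' = 0)
    (heq : F.curryLeft + wedgeMap B ℓ G + A₀ = F'.curryLeft + wedgeMap B ℓ G' + A₀') :
    F = F' ∧ G = G' ∧ A₀ = A₀' := by
  have hF : F = F' := by
    refine smul_right_injective _ (Nat.cast_add_one_ne_zero ℓ : (ℓ : ℝ) + 1 ≠ 0) ?_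
    exact (h.alternatizeUncurryFin_decomposition rfl hA).symm.trans
      (h.alternatizeUncurryFin_decomposition heq hA')
  have hGG : G = G' := by
    refine smul_right_injective _ (cast_sub_cast_add_one_ne_zero hℓ) ?_
    exact (h.formTrace_decomposition rfl hG hT).symm.trans
      (h.formTrace_decomposition heq hG' hT')
  subst hF hGG
  exact ⟨rfl, rfl, add_left_cancel heq⟩

variable {S : Type*} [AddCommGroup S] [Module ℝ S] [Module 𝕜 S] [IsScalarTower ℝ 𝕜 S]
  [Nontrivial S] {γ : T →ₗ[ℝ] Module.End 𝕜 S}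

include h in
/-- The pointwise form of the characterization of admissible connections: the vanishing of
`𝒜_Z Z + Z 𝒜_Z^C` for all `Z`, where `𝒜_Z^C = τ 𝒜_Z`. -/
theorem IsOrthonormalFrame.anticommute_iff
    (hγ : ∀ X Y, γ X * γ Y + γ Y * γ X = (-2 * B X Y) • (1 : Module.End 𝕜 S))
    {ℓ : ℕ} (hℓ : ℓ ≤ n) {F : T [⋀^Fin (ℓ + 1)]→ₗ[ℝ] 𝕜} {G : T [⋀^Fin (ℓ - 1)]→ₗ[ℝ] 𝕜}
    {α A₀ : T →ₗ[ℝ] T [⋀^Fin ℓ]→ₗ[ℝ] 𝕜} (hG : ℓ = 0 → G = 0)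
    (hA : alternatizeUncurryFin A₀ = 0) (hT : formTrace ε e ℓ A₀ = 0)
    (hα : α = F.curryLeft + wedgeMap B ℓ G + A₀) {τ : ℝ} (hτ : τ = 1 ∨ τ = -1) :
    (∀ Z, cliffordLM ε e γ ℓ (α Z) * γ Z + τ • (γ Z * cliffordLM ε e γ ℓ (α Z)) = 0) ↔
      A₀ = 0 ∧ (F ≠ 0 → τ = -(-1) ^ ℓ) ∧ (G ≠ 0 → τ = (-1) ^ ℓ) := by
  have h1 : (ℓ : ℝ) + 1 ≠ 0 := Nat.cast_add_one_ne_zero ℓ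
  have h2 := cast_sub_cast_add_one_ne_zero hℓ
  have hp : (-1 : ℝ) ^ ℓ ≠ 0 := pow_ne_zero _ (by norm_num)
  have hF' := h.alternatizeUncurryFin_decomposition hα hA
  have hG' := h.formTrace_decomposition hα hG hT
  have hexp : ∀ Z, cliffordLM ε e γ ℓ (α Z) * γ Z + τ • (γ Z * cliffordLM ε e γ ℓ (α Z)) =
      ((-1) ^ ℓ + τ) • cliffordLM ε e γ (ℓ + 1) (wedgeLM 𝕜 B ℓ Z (α Z)) +
        ((-1) ^ ℓ - τ) • cliffordLM ε e γ (ℓ - 1) (contract Z (α Z)) := by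
    intro Z
    rw [clifford_mul_right h hγ, clifford_mul h hγ]
    module
  have hcases : τ = (-1) ^ ℓ ∨ τ = -(-1) ^ ℓ := by
    rcases neg_one_pow_eq_or ℝ ℓ with h' | h' <;> rw [h'] <;> rcases hτ with h'' | h'' <;>
      simp [h'']
  simp only [hexp]
  -- The first case leaves only the wedge term and forces $\alpha(Z)=Z\wedge G$; the second leaves
  -- only the contraction and forces $\alpha(Z)=Z\rfloor F$.
  rcases hcases with rfl | rfl
  · have hne : (-1 : ℝ) ^ ℓ ≠ -(-1) ^ ℓ := fun hh => hp (by linarith)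
    have h2p : (-1 : ℝ) ^ ℓ + (-1) ^ ℓ ≠ 0 := by
      intro hh
      exact hp (by linarith)
    constructor
    · intro hZ
      have hw : ∀ Z, wedgeLM 𝕜 B ℓ Z (α Z) = 0 := by
        intro Z
        have := hZ Z
        rw [sub_self, zero_smul, add_zero] at this
        exact cliffordLM_injective h hγ _ _ ((smul_eq_zero.1 this).resolve_left h2p)
      have hαG : α = wedgeMap B ℓ G := by
        ext1 Z
        refine smul_right_injective _ h2 ?_
        refine (h.eq_wedge_of_wedge_eq_zero hw Z).trans ?_
        rw [hG', ← wedgeMap_apply, wedgeMap_smul]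
        rfl
      have hF0 : F = 0 := by
        rw [hαG, h.alternatizeUncurryFin_wedgeMap] at hF'
        exact (smul_eq_zero.1 hF'.symm).resolve_left h1
      refine ⟨?_, fun hh => absurd hF0 hh, fun _ => rfl⟩
      rw [hF0, hαG] at hα
      simpa using hα
    · rintro ⟨rfl, hF0, -⟩ Z
      have hF0 : F = 0 := by
        by_contra hF
        exact hne (hF0 hF)
      have hw : wedgeLM 𝕜 B ℓ Z (α Z) = 0 := by
        rw [hα, hF0]
        simp only [AlternatingMap.curryLeft_zero, zero_add, add_zero, wedgeMap_apply]
        cases ℓ with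
        | zero => simp [wedge]
        | succ ℓ => exact wedgeLM_wedgeLM_self B Z G
      rw [hw, map_zero, smul_zero, sub_self, zero_smul, add_zero]
  · have hne : -(-1 : ℝ) ^ ℓ ≠ (-1) ^ ℓ := fun hh => hp (by linarith)
    have h2p : (-1 : ℝ) ^ ℓ - -(-1) ^ ℓ ≠ 0 := by
      intro hh
      exact hp (by linarith)
    constructor
    · intro hZ
      have hw : ∀ Z, contract Z (α Z) = 0 := by
        intro Z
        have := hZ Z
        rw [add_neg_cancel, zero_smul, zero_add] at this
        exact cliffordLM_injective h hγ _ _ ((smul_eq_zero.1 this).resolve_left h2p)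
      have hαF : α = F.curryLeft := by
        ext1 Z
        refine smul_right_injective _ h1 ?_
        refine (eq_curryLeft_of_contract_eq_zero hw Z).trans ?_
        rw [hF', AlternatingMap.curryLeft_smul]
        rfl
      have hG0 : G = 0 := by
        rw [hαF, formTrace_curryLeft] at hG'
        exact (smul_eq_zero.1 hG'.symm).resolve_left h2
      refine ⟨?_, fun _ => rfl, fun hh => absurd hG0 hh⟩
      rw [hG0, hαF, wedgeMap_zero] at hα
      simpa using hα
    · rintro ⟨rfl, -, hG0⟩ Z
      have hG0 : G = 0 := by
        by_contra hG
        exact hne (hG0 hG)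
      have hw : contract Z (α Z) = 0 := by
        rw [hα, hG0, wedgeMap_zero, add_zero, add_zero]
        exact contract_contract_self Z F
      rw [hw, map_zero, smul_zero, add_neg_cancel, zero_smul, add_zero]

end Decomposition

end

/-! ### Differentiability in moving frames -/

section Frames

open Bundle

variable {E : Type*} [NormedAddCommGroup E] [NormedSpace ℝ E]
  {M : Type*} [TopologicalSpace M] [ChartedSpace E M]
  {F : Type*} [NormedAddCommGroup F] [NormedSpace ℝ F]
  {V : M → Type*} [TopologicalSpace (TotalSpace F V)]
  [∀ x, AddCommGroup (V x)] [∀ x, Module ℝ (V x)] [∀ x, TopologicalSpace (V x)]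
  [FiberBundle F V] [VectorBundle ℝ F V]
  {F' : Type*} [NormedAddCommGroup F'] [NormedSpace ℝ F'] [FiniteDimensional ℝ F']

/-- A section with differentiable coordinates in a differentiable frame is differentiable. -/
theorem mdifferentiableAt_frame_apply {x : M} {θ : Π y, F' ≃ₗ[ℝ] V y}
    (hθ : ∀ ψ, MDiffAt (T% (fun y => θ y ψ)) x) {u : M → F'} (hu : MDiffAt u x) :
    MDiffAt (T% (fun y => θ y (u y))) x := by
  let b := Module.finBasis ℝ F'
  have h1 : (fun y => θ y (u y)) = fun y => ∑ i, (b.coord i (u y)) • θ y (b i) := by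
    ext y
    have := congrArg (θ y) (b.sum_repr (u y))
    rw [← this, map_sum]
    simp only [map_smul, Module.Basis.coord_apply]
  have h2 : (T% (fun y => θ y (u y))) = T% (fun y => ∑ i, (b.coord i (u y)) • θ y (b i)) := by
    ext1 y
    exact congrArg (TotalSpace.mk' F y) (congrFun h1 y)
  rw [h2]
  refine MDifferentiableAt.sum_section fun i _ => ?_
  refine MDifferentiableAt.smul_section (f := fun y => b.coord i (u y)) ?_ (hθ (b i))
  exact (LinearMap.toContinuousLinearMap (b.coord i)).differentiableAt.comp_mdifferentiableAt hu

/-- The coordinates of a differentiable section in a differentiable frame are differentiable. -/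
theorem mdifferentiableAt_frame_symm_apply [ContMDiffVectorBundle 1 F V 𝓘(ℝ, E)] {x : M} {θ : Π y, F' ≃ₗ[ℝ] V y}
    (hθ : ∀ ψ, MDiffAt (T% (fun y => θ y ψ)) x) {ξ : Π y, V y} (hξ : MDiffAt (T% ξ) x) :
    MDiffAt (fun y => (θ y).symm (ξ y)) x := by
  let t := trivializationAt F V x
  have hx : x ∈ t.baseSet := mem_baseSet_trivializationAt F V x
  -- The frame read in a local trivialization. It is invertible over the base set, and inversion of
  -- continuous linear maps is differentiable there.
  let P : M → F' →L[ℝ] F := fun y =>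
    LinearMap.toContinuousLinearMap ((t.linearMapAt ℝ y) ∘ₗ (θ y : F' →ₗ[ℝ] V y))
  let N : ∀ y ∈ t.baseSet, F' ≃L[ℝ] F := fun y hy =>
    ((θ y).trans (t.linearEquivAt ℝ y hy)).toContinuousLinearEquiv
  have hN : ∀ y (hy : y ∈ t.baseSet), P y = N y hy := by
    intro y hy
    ext ψ
    simp [P, N, t.coe_linearMapAt_of_mem hy]
  have hnhds : ∀ᶠ y in nhds x, y ∈ t.baseSet := t.open_baseSet.mem_nhds hx
  have hPψ : ∀ ψ, MDiffAt (fun y => P y ψ) x := by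
    intro ψ
    refine ((t.mdifferentiableAt_section_iff 𝓘(ℝ, E) _ hx).1 (hθ ψ)).congr_of_eventuallyEq ?_
    filter_upwards [hnhds] with y hy
    simp [P, t.coe_linearMapAt_of_mem hy]
  have hP : MDiffAt P x := by
    let b := Module.finBasis ℝ F'
    have h1 : P = fun y => ∑ i, ContinuousLinearMap.smulRightL ℝ F' F
        (LinearMap.toContinuousLinearMap (b.coord i)) (P y (b i)) := by
      ext y ψ
      have := congrArg (P y) (b.sum_repr ψ)
      rw [← this, map_sum, sum_apply]
      simp only [map_smul]
      rfl
    rw [h1]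
    have h2 : ∀ i ∈ Finset.univ, MDiffAt (fun y => ContinuousLinearMap.smulRightL ℝ F' F
        (LinearMap.toContinuousLinearMap (b.coord i)) (P y (b i))) x := fun i _ =>
      (ContinuousLinearMap.smulRightL ℝ F' F
        (LinearMap.toContinuousLinearMap (b.coord i))).differentiableAt.comp_mdifferentiableAt
          (hPψ (b i))
    convert! MDifferentiableAt.sum h2 using 1
    ext1 y
    simp
  have hinv : MDiffAt (fun y => (P y).inverse) x := by
    have h1 : DifferentiableAt ℝ (ContinuousLinearMap.inverse : (F' →L[ℝ] F) → (F →L[ℝ] F'))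
        (P x) := by
      rw [hN x hx]
      exact (contDiffAt_map_inverse (n := 1) (N x hx)).differentiableAt one_ne_zero
    exact h1.comp_mdifferentiableAt hP
  have hξ' := (t.mdifferentiableAt_section_iff 𝓘(ℝ, E) _ hx).1 hξ
  refine (hinv.clm_apply hξ').congr_of_eventuallyEq ?_
  filter_upwards [hnhds] with y hy
  rw [hN y hy, ContinuousLinearMap.inverse_equiv]
  simp [N]
  exact (t.symm_apply_apply_mk hy _).symm

end Frames

/-! ### The spin connection form and Clifford multiplication -/

section SpinConnection

variable {𝕜 : Type*} [RCLike 𝕜] {T : Type*} [AddCommGroup T] [Module ℝ T]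
  {S : Type*} [AddCommGroup S] [Module ℝ S] [Module 𝕜 S] [IsScalarTower ℝ 𝕜 S]
  {n : ℕ} {ε : Fin n → ℤˣ} {e : Fin n → T} {B : T →ₗ[ℝ] T →ₗ[ℝ] ℝ}
  {γ : T →ₗ[ℝ] Module.End 𝕜 S}

/-- The commutator of the spin connection form with Clifford multiplication, for a skew
endomorphism which maps `e_a` to `w_a` and `X` to `Y`. -/
theorem IsOrthonormalFrame.sum_commutator (h : IsOrthonormalFrame ε e B)
    (hγ : ∀ X Y, γ X * γ Y + γ Y * γ X = (-2 * B X Y) • (1 : Module.End 𝕜 S))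
    {w : Fin n → T} {X Y : T} (hw : ∀ a b, B (w a) (e b) = -B (w b) (e a))
    (hX : ∀ b, B Y (e b) = -B (w b) X) :
    (1 / 4 : ℝ) • ∑ a, ∑ b, (sgn (ε a) * sgn (ε b) * B (w a) (e b)) •
      (γ (e a) * γ (e b) * γ X - γ X * (γ (e a) * γ (e b))) = γ Y := by
  -- The action of $\mathfrak{spin}$ on vectors: the commutator of $e_ae_b$ with a vector is again a
  -- vector. By skewness of the coefficients the two resulting terms contribute equally, and
  -- $\frac14$ cancels $2+2$.
  have hcomm : ∀ a b, γ (e a) * γ (e b) * γ X - γ X * (γ (e a) * γ (e b)) =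
      (2 * B (e a) X) • γ (e b) - (2 * B (e b) X) • γ (e a) := by
    intro a b
    have h1 := congrArg (γ (e a) * ·) (hγ (e b) X)
    have h2 := congrArg (· * γ (e b)) (hγ (e a) X)
    simp only [mul_add, add_mul, mul_smul_comm, smul_mul_assoc, mul_one, one_mul] at h1 h2
    have h3 : γ (e a) * γ (e b) * γ X - γ X * (γ (e a) * γ (e b)) =
        (γ (e a) * (γ (e b) * γ X) + γ (e a) * (γ X * γ (e b))) -
          (γ (e a) * γ X * γ (e b) + γ X * γ (e a) * γ (e b)) := by
      noncomm_ring
    rw [h3, h1, h2]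
    module
  have hsum : ∀ b, ∑ a, (sgn (ε a) * B (w b) (e a) * B (e a) X) = B (w b) X := by
    intro b
    rw [← h.sum_smul_map (B (w b)) X]
    exact Finset.sum_congr rfl fun a _ => by rw [smul_eq_mul]; ring
  have hY : ∑ b, (sgn (ε b) * -B (w b) X) • γ (e b) = γ Y := by
    rw [← h.sum_smul_map γ Y]
    exact Finset.sum_congr rfl fun b _ => by rw [h.symm (e b) Y, hX]
  simp only [hcomm, smul_sub, smul_smul, Finset.sum_sub_distrib]
  have h1 : ∑ a, ∑ b, (sgn (ε a) * sgn (ε b) * B (w a) (e b) * (2 * B (e a) X)) • γ (e b) =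
      (2 : ℝ) • γ Y := by
    rw [Finset.sum_comm, ← hY, Finset.smul_sum]
    refine Finset.sum_congr rfl fun b _ => ?_
    rw [← Finset.sum_smul, smul_smul, ← hsum b]
    congr 1
    rw [← Finset.sum_neg_distrib, Finset.mul_sum, Finset.mul_sum]
    refine Finset.sum_congr rfl fun a _ => ?_
    rw [hw a b]
    ring
  have h2 : ∑ a, ∑ b, (sgn (ε a) * sgn (ε b) * B (w a) (e b) * (2 * B (e b) X)) • γ (e a) =
      (-2 : ℝ) • γ Y := by
    rw [← hY, Finset.smul_sum]
    refine Finset.sum_congr rfl fun a _ => ?_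
    rw [← Finset.sum_smul, smul_smul, ← hsum a]
    congr 1
    rw [← Finset.sum_neg_distrib, Finset.mul_sum, Finset.mul_sum]
    refine Finset.sum_congr rfl fun b _ => ?_
    ring
  rw [h1, h2]
  module

end SpinConnection

/-! ### Clifford multiplication and charge adjoint on the spinor bundle -/

section SpinBundle

variable {𝕜 : Type*} [RCLike 𝕜]
  {E : Type*} [NormedAddCommGroup E] [NormedSpace ℝ E]
  {M : Type*} [TopologicalSpace M] [ChartedSpace E M] [IsManifold 𝓘(ℝ, E) ∞ M]
  {F : Type*} [NormedAddCommGroup F] [NormedSpace ℝ F] [NormedSpace 𝕜 F] [IsScalarTower ℝ 𝕜 F]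
  {n : ℕ} {ε : Fin n → ℤˣ}
  {S : M → Type*} [TopologicalSpace (Bundle.TotalSpace F S)]
  [∀ x, AddCommGroup (S x)] [∀ x, Module 𝕜 (S x)]
  [∀ x, TopologicalSpace (S x)]
  [FiberBundle F S]
  {g : PseudoRiemannianMetric E M} {ρ : SpinorModule 𝕜 F ε}

theorem modelInner_single_left (ε : Fin n → ℤˣ) (a : Fin n) (v : Fin n → ℝ) :
    modelInner ε (Pi.single a 1) v = sgn (ε a) * v a := by
  rw [modelInner, Finset.sum_eq_single a]
  · simp
  · intro b _ hb
    simp [hb]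
  · simp

theorem ι_mul_ι_add_swap (v w : Fin n → ℝ) :
    CliffordAlgebra.ι (cliffordForm ε) v * CliffordAlgebra.ι (cliffordForm ε) w +
      CliffordAlgebra.ι (cliffordForm ε) w * CliffordAlgebra.ι (cliffordForm ε) v =
      algebraMap ℝ _ (-2 * modelInner ε v w) := by
  rw [CliffordAlgebra.ι_mul_ι_add_swap]
  congr 1
  simp only [QuadraticMap.polar, cliffordForm, QuadraticMap.weightedSumSquares_apply, modelInner,
    Pi.add_apply, smul_eq_mul]
  rw [← Finset.sum_sub_distrib, ← Finset.sum_sub_distrib, Finset.mul_sum]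
  exact Finset.sum_congr rfl fun a _ => by ring

namespace SpinStructure

variable (σ : SpinStructure (𝕜 := 𝕜) S g ρ)

theorem metric_apply (x : M) (X Y : TangentSpace 𝓘(ℝ, E) x) :
    metric g x X Y = g.inner x X Y := rfl

theorem isOrthonormalFrame {x : M} {p : FramePair 𝕜 (E := E) F n S x} (hp : p ∈ σ.P x) :
    IsOrthonormalFrame ε (fun a => p.1 (Pi.single a 1)) (metric g x) where
  symm := g.symm x
  norm a := by
    rw [metric_apply, σ.orthonormal hp, modelInner_single_left]
    simp
  expand X := by
    obtain ⟨v, rfl⟩ := p.1.surjective X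
    have h1 : ∀ a, sgn (ε a) * metric g x (p.1 (Pi.single a 1)) (p.1 v) = v a := by
      intro a
      rw [metric_apply, σ.orthonormal hp, modelInner_single_left, ← mul_assoc, sgn_mul_self,
        one_mul]
    simp only [h1, ← map_smul, ← map_sum]
    congr 1
    exact (pi_eq_sum_univ' v).symm

theorem isOrthonormalFrame_e (x : M) : IsOrthonormalFrame ε (σ.e x) (metric g x) :=
  σ.isOrthonormalFrame (σ.framePair_mem x)

include ρ in
theorem nontrivial_spinor [FiniteDimensional 𝕜 F] : Nontrivial F :=
  Module.nontrivial_of_finrank_pos (R := 𝕜) (by rw [ρ.finrank_eq]; positivity)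

include σ in
theorem nontrivial_fiber [FiniteDimensional 𝕜 F] (x : M) : Nontrivial (S x) :=
  have := nontrivial_spinor (ρ := ρ)
  (σ.framePair x).2.symm.toEquiv.nontrivial

variable [∀ x, Module ℝ (S x)] [∀ x, IsScalarTower ℝ 𝕜 (S x)]

/-- Clifford multiplication as a linear map. -/
def gammaLM (x : M) : TangentSpace 𝓘(ℝ, E) x →ₗ[ℝ] Module.End 𝕜 (S x) where
  toFun := σ.gamma x
  map_add' X Y := by simp [gamma]
  map_smul' r X := by
    ext ψ
    simp only [gamma, map_smul, RingHom.id_apply, LinearMap.smul_apply,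
      LinearEquiv.conj_apply_apply]
    rw [← algebraMap_smul 𝕜 r, map_smul, algebraMap_smul]

theorem gammaLM_apply (x : M) (X : TangentSpace 𝓘(ℝ, E) x) : σ.gammaLM x X = σ.gamma x X := rfl

theorem gamma_mul_add_swap (x : M) (X Y : TangentSpace 𝓘(ℝ, E) x) :
    σ.gammaLM x X * σ.gammaLM x Y + σ.gammaLM x Y * σ.gammaLM x X =
      (-2 * metric g x X Y) • (1 : Module.End 𝕜 (S x)) := by
  obtain ⟨v, rfl⟩ := (σ.framePair x).1.surjective X
  obtain ⟨w, rfl⟩ := (σ.framePair x).1.surjective Y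
  ext ξ
  obtain ⟨ψ, rfl⟩ := (σ.framePair x).2.surjective ξ
  have hp := σ.framePair_mem x
  have h1 : ρ.act (CliffordAlgebra.ι _ v * CliffordAlgebra.ι _ w +
      CliffordAlgebra.ι _ w * CliffordAlgebra.ι _ v) ψ = (-2 * modelInner ε v w) • ψ := by
    rw [ι_mul_ι_add_swap, AlgHom.commutes, Module.algebraMap_end_apply]
  have h2 := congrArg (σ.framePair x).2 h1
  rw [← algebraMap_smul 𝕜 (_ : ℝ) ψ, map_smul, algebraMap_smul] at h2
  simp only [LinearMap.add_apply, Module.End.mul_apply, gammaLM_apply, σ.gamma_apply hp,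
    metric_apply, σ.orthonormal hp, LinearMap.smul_apply, Module.End.one_apply]
  rw [← h2]
  simp only [map_add, map_mul, LinearMap.add_apply, Module.End.mul_apply]

theorem ofForm_eq (x : M) {ℓ : ℕ} (w : TangentSpace 𝓘(ℝ, E) x [⋀^Fin ℓ]→ₗ[ℝ] 𝕜) :
    σ.ofForm x w = cliffordLM ε (σ.e x) (σ.gammaLM x) ℓ w := rfl

theorem form_gamma (C : ChargeConjugation ρ) (x : M) (X : TangentSpace 𝓘(ℝ, E) x) (φ ψ : S x) :
    σ.form C x φ (σ.gammaLM x X ψ) = sgn (C.Δ₀ * C.Δ₁) • σ.form C x (σ.gammaLM x X φ) ψ := by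
  obtain ⟨v, rfl⟩ := (σ.framePair x).1.surjective X
  obtain ⟨φ, rfl⟩ := (σ.framePair x).2.surjective φ
  obtain ⟨ψ, rfl⟩ := (σ.framePair x).2.surjective ψ
  have hp := σ.framePair_mem x
  rw [gammaLM_apply, σ.gamma_apply hp, σ.gamma_apply hp, σ.form_apply C hp, σ.form_apply C hp,
    C.form_act_ι, sgn, Int.cast_smul_eq_zsmul, smul_smul]
  rcases Int.units_eq_one_or (C.Δ₀ * C.Δ₁) with h | h <;> simp [h]

/-- The charge adjoint of the action of a form. -/
theorem adjoint_ofForm [FiniteDimensional 𝕜 F] (C : ChargeConjugation ρ) (x : M) {ℓ : ℕ}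
    (w : TangentSpace 𝓘(ℝ, E) x [⋀^Fin ℓ]→ₗ[ℝ] 𝕜) :
    σ.adjoint C x (σ.ofForm x w) = adjointSign (sgn (C.Δ₀ * C.Δ₁)) ℓ • σ.ofForm x w := by
  ext η
  have hnd : (σ.form C x).Nondegenerate := C.nondegenerate.congr _
  rw [← sub_eq_zero]
  refine hnd.1 _ fun ξ => ?_
  rw [map_sub, LinearMap.sub_apply, σ.form_adjoint, ofForm_eq,
    form_cliffordLM (σ.isOrthonormalFrame_e x) (σ.gamma_mul_add_swap x) (σ.form_gamma C x),
    LinearMap.smul_apply, ← algebraMap_smul 𝕜 (adjointSign _ _) (cliffordLM _ _ _ _ _ _), map_smul,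
    LinearMap.smul_apply, algebraMap_smul, sub_self]

end SpinStructure

end SpinBundle

/-! ### Clifford multiplication is parallel -/

namespace SpinStructure

variable {𝕜 : Type*} [RCLike 𝕜]
  {E : Type*} [NormedAddCommGroup E] [NormedSpace ℝ E]
  {M : Type*} [TopologicalSpace M] [ChartedSpace E M] [IsManifold 𝓘(ℝ, E) ∞ M]
  {F : Type*} [NormedAddCommGroup F] [NormedSpace ℝ F] [NormedSpace 𝕜 F] [IsScalarTower ℝ 𝕜 F]
  {n : ℕ} {ε : Fin n → ℤˣ}
  {S : M → Type*} [TopologicalSpace (Bundle.TotalSpace F S)]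
  [∀ x, AddCommGroup (S x)] [∀ x, Module 𝕜 (S x)]
  [∀ x, TopologicalSpace (S x)] [FiberBundle F S]
  {g : PseudoRiemannianMetric E M} {ρ : SpinorModule 𝕜 F ε}
  (σ : SpinStructure (𝕜 := 𝕜) S g ρ)

theorem exists_isSpinFrame (x : M) : ∃ (U : Set M) (s : Π y : M, FramePair 𝕜 (E := E) F n S y),
    x ∈ U ∧ σ.IsSpinFrame U s := by
  obtain ⟨U, hU, hx, s, hs, h1, h2⟩ := σ.exists_section x
  exact ⟨U, s, hx, hU, hs, h1, h2⟩

section SpinFrame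

variable {σ} {U : Set M} {s : Π y : M, FramePair 𝕜 (E := E) F n S y} (hs : σ.IsSpinFrame U s)
  {x : M} (hx : x ∈ U)

include hs hx

theorem IsSpinFrame.mdifferentiableAt_fst (v : Fin n → ℝ) :
    MDiffAt (T% (fun y => ((s y).1 v : TangentSpace 𝓘(ℝ, E) y))) x :=
  ((hs.contMDiffOn_fst v).contMDiffAt (hs.isOpen.mem_nhds hx)).mdifferentiableAt (by simp)

theorem IsSpinFrame.mdifferentiableAt_snd (ψ : F) : MDiffAt (T% (fun y => (s y).2 ψ)) x :=
  ((hs.contMDiffOn_snd ψ).contMDiffAt (hs.isOpen.mem_nhds hx)).mdifferentiableAt (by simp)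

theorem IsSpinFrame.eventually_gamma_apply (v : Fin n → ℝ) (ψ : F) :
    ∀ᶠ y in nhds x, σ.gamma y ((s y).1 v) ((s y).2 ψ) =
      (s y).2 (ρ.act (CliffordAlgebra.ι (cliffordForm ε) v) ψ) := by
  filter_upwards [hs.isOpen.mem_nhds hx] with y hy
  exact σ.gamma_apply (hs.mem y hy) v ψ

end SpinFrame

variable [FiniteDimensional 𝕜 F]
  [∀ x, Module ℝ (S x)] [∀ x, IsScalarTower ℝ 𝕜 (S x)]
  [VectorBundle ℝ F S] [ContMDiffVectorBundle ∞ F S 𝓘(ℝ, E)]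

/-- The Clifford product of differentiable sections is differentiable. -/
theorem mdifferentiableAt_gamma {x : M} {X : Π y : M, TangentSpace 𝓘(ℝ, E) y} {ξ : Π y : M, S y}
    (hX : MDiffAt (T% X) x) (hξ : MDiffAt (T% ξ) x) :
    MDiffAt (T% (fun y => σ.gamma y (X y) (ξ y))) x := by
  have : FiniteDimensional ℝ F := FiniteDimensional.trans ℝ 𝕜 F
  have : ContMDiffVectorBundle 1 F S 𝓘(ℝ, E) := ContMDiffVectorBundle.of_le (n := ∞) (by simp)
  have : IsManifold 𝓘(ℝ, E) 1 M := IsManifold.of_le (n := ∞) (by simp)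
  obtain ⟨U, s, hx, hs⟩ := σ.exists_isSpinFrame x
  let θ : Π y, F ≃ₗ[ℝ] S y := fun y => (s y).2.restrictScalars ℝ
  have hθ : ∀ ψ, MDiffAt (T% (fun y => θ y ψ)) x := hs.mdifferentiableAt_snd hx
  have h1 : MDifferentiableAt 𝓘(ℝ, E) 𝓘(ℝ, Fin n → ℝ) (fun y => (s y).1.symm (X y)) x :=
    mdifferentiableAt_frame_symm_apply (hs.mdifferentiableAt_fst hx) hX
  have h2 : MDiffAt (fun y => (θ y).symm (ξ y)) x := mdifferentiableAt_frame_symm_apply hθ hξ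
  let m : (Fin n → ℝ) →ₗ[ℝ] F →ₗ[ℝ] F :=
    LinearMap.mk₂ ℝ (fun v ψ => ρ.act (CliffordAlgebra.ι (cliffordForm ε) v) ψ)
      (by simp) (by simp) (by simp)
      (fun r v ψ => by rw [← algebraMap_smul 𝕜 r, map_smul, algebraMap_smul])
  let L : (Fin n → ℝ) →L[ℝ] F →L[ℝ] F :=
    LinearMap.toContinuousLinearMap ((LinearMap.toContinuousLinearMap :
      (F →ₗ[ℝ] F) ≃ₗ[ℝ] (F →L[ℝ] F)).toLinearMap ∘ₗ m)
  have h3 : MDiffAt (fun y => L ((s y).1.symm (X y)) ((θ y).symm (ξ y))) x :=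
    (L.differentiableAt.comp_mdifferentiableAt h1).clm_apply h2
  refine (mdifferentiableAt_frame_apply hθ h3).congr_of_eventuallyEq ?_
  filter_upwards [hs.isOpen.mem_nhds hx] with y hy
  refine congrArg (Bundle.TotalSpace.mk' F y) ?_
  have h4 := σ.gamma_apply (hs.mem y hy) ((s y).1.symm (X y)) ((s y).2.symm (ξ y))
  rw [LinearEquiv.apply_symm_apply, LinearEquiv.apply_symm_apply] at h4
  exact h4

variable [FiniteDimensional ℝ E]
  [∀ x, IsTopologicalAddGroup (S x)] [∀ x, ContinuousSMul ℝ (S x)]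

/-- Clifford multiplication is parallel: `∇_Z (X ξ) = (∇_Z X) ξ + X ∇_Z ξ`. -/
theorem nabla_gamma {nabla : CovariantDerivative 𝓘(ℝ, E) E (TangentSpace 𝓘(ℝ, E) : M → Type _)}
    (hnabla : IsLeviCivita g nabla) {nablaS : CovariantDerivative 𝓘(ℝ, E) F S}
    (hnablaS : σ.IsSpinLeviCivita nabla nablaS)
    {x : M} {X : Π y : M, TangentSpace 𝓘(ℝ, E) y} {ξ : Π y : M, S y}
    (hX : MDiffAt (T% X) x) (hξ : MDiffAt (T% ξ) x) (Z : TangentSpace 𝓘(ℝ, E) x) :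
    nablaS (fun y => σ.gamma y (X y) (ξ y)) x Z =
      σ.gamma x (nabla X x Z) (ξ x) + σ.gamma x (X x) (nablaS ξ x Z) := by
  have : FiniteDimensional ℝ F := FiniteDimensional.trans ℝ 𝕜 F
  have : ContMDiffVectorBundle 1 F S 𝓘(ℝ, E) := ContMDiffVectorBundle.of_le (n := ∞) (by simp)
  have : IsManifold 𝓘(ℝ, E) 1 M := IsManifold.of_le (n := ∞) (by simp)
  -- The defect in the product rule. It is tensorial in both sections, so `X` and `ξ` may be
  -- replaced by sections with constant coefficients in a spin frame.
  let Φ : (Π y : M, TangentSpace 𝓘(ℝ, E) y) → (Π y : M, S y) → S x := fun X ξ =>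
    nablaS (fun y => σ.gamma y (X y) (ξ y)) x Z - σ.gammaLM x (nabla X x Z) (ξ x) -
      σ.gammaLM x (X x) (nablaS ξ x Z)
  have hsmul : ∀ (y : M) (Φ : Module.End 𝕜 (S y)) (r : ℝ) (ψ : S y), Φ (r • ψ) = r • Φ ψ :=
    fun y Φ r ψ => by rw [← algebraMap_smul 𝕜 r, map_smul, algebraMap_smul]
  have hΦ₁ : ∀ ξ, MDiffAt (T% ξ) x → TensorialAt 𝓘(ℝ, E) E (Φ · ξ) x := fun ξ hξ =>
    { smul := by
        intro f X hf hX
        have h1 : (fun y => σ.gamma y ((f • X) y) (ξ y)) = f • fun y => σ.gamma y (X y) (ξ y) := by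
          ext y
          exact congrArg (fun L : Module.End 𝕜 (S y) => L (ξ y)) ((σ.gammaLM y).map_smul (f y) (X y))
        simp only [Φ]
        rw [h1, nablaS.isCovariantDerivativeOnUniv.leibniz (σ.mdifferentiableAt_gamma hX hξ) hf,
          nabla.isCovariantDerivativeOnUniv.leibniz hX hf]
        simp [← gammaLM_apply]
        module
      add := by
        intro X Y hX hY
        have h1 : (fun y => σ.gamma y ((X + Y) y) (ξ y)) =
            (fun y => σ.gamma y (X y) (ξ y)) + fun y => σ.gamma y (Y y) (ξ y) := by
          ext y
          exact congrArg (fun L : Module.End 𝕜 (S y) => L (ξ y)) ((σ.gammaLM y).map_add (X y) (Y y))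
        simp only [Φ]
        rw [h1, nablaS.isCovariantDerivativeOnUniv.add (σ.mdifferentiableAt_gamma hX hξ)
          (σ.mdifferentiableAt_gamma hY hξ), nabla.isCovariantDerivativeOnUniv.add hX hY]
        simp
        abel }
  have hΦ₂ : ∀ X, MDiffAt (T% X) x → TensorialAt 𝓘(ℝ, E) F (Φ X ·) x := fun X hX =>
    { smul := by
        intro f ξ hf hξ
        have h1 : (fun y => σ.gamma y (X y) ((f • ξ) y)) = f • fun y => σ.gamma y (X y) (ξ y) := by
          ext y
          exact hsmul y _ (f y) (ξ y)
        simp only [Φ]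
        rw [h1, nablaS.isCovariantDerivativeOnUniv.leibniz (σ.mdifferentiableAt_gamma hX hξ) hf,
          nablaS.isCovariantDerivativeOnUniv.leibniz hξ hf]
        simp [← gammaLM_apply, hsmul]
        module
      add := by
        intro ξ η hξ hη
        have h1 : (fun y => σ.gamma y (X y) ((ξ + η) y)) =
            (fun y => σ.gamma y (X y) (ξ y)) + fun y => σ.gamma y (X y) (η y) := by
          ext y
          exact map_add _ _ _
        simp only [Φ]
        rw [h1, nablaS.isCovariantDerivativeOnUniv.add (σ.mdifferentiableAt_gamma hX hξ)
          (σ.mdifferentiableAt_gamma hX hη), nablaS.isCovariantDerivativeOnUniv.add hξ hη]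
        simp
        abel }
  obtain ⟨U, s, hx, hs⟩ := σ.exists_isSpinFrame x
  obtain ⟨v, hv⟩ := (s x).1.surjective (X x)
  obtain ⟨ψ, hψ⟩ := (s x).2.surjective (ξ x)
  have hpt : Φ X ξ = Φ (fun y => (s y).1 v) (fun y => (s y).2 ψ) :=
    TensorialAt.pointwise₂ hΦ₁ hΦ₂ hX (hs.mdifferentiableAt_fst hx v) hξ
      (hs.mdifferentiableAt_snd hx ψ) hv.symm hψ.symm
  suffices h : Φ (fun y => (s y).1 v) (fun y => (s y).2 ψ) = 0 by
    rw [h] at hpt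
    simp only [Φ, gammaLM_apply, sub_sub, sub_eq_zero] at hpt
    exact hpt
  have hfr := σ.isOrthonormalFrame (hs.mem x hx)
  -- Near `x` the Clifford product of such sections again has constant coefficients, so the formula
  -- for `nablaS` applies to it.
  have hgeq : nablaS (fun y => σ.gamma y ((s y).1 v) ((s y).2 ψ)) x =
      nablaS (fun y => (s y).2 (ρ.act (CliffordAlgebra.ι (cliffordForm ε) v) ψ)) x :=
    nablaS.isCovariantDerivativeOnUniv.congr_of_eventuallyEq
      (σ.mdifferentiableAt_gamma (hs.mdifferentiableAt_fst hx v) (hs.mdifferentiableAt_snd hx ψ))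
      (hs.mdifferentiableAt_snd hx _) Filter.univ_mem (hs.eventually_gamma_apply hx v ψ)
  -- Scalar products of constant-coefficient sections of an orthonormal frame are locally constant,
  -- so metric compatibility makes the connection form skew.
  have hskew : ∀ v w : Fin n → ℝ, metric g x (nabla (fun y => (s y).1 v) x Z) ((s x).1 w) =
      -metric g x (nabla (fun y => (s y).1 w) x Z) ((s x).1 v) := by
    intro v w
    have h1 := hnabla.metric x (fun y => (s y).1 v) (fun y => (s y).1 w) Z
      (hs.mdifferentiableAt_fst hx v) (hs.mdifferentiableAt_fst hx w)
    have h2 : (fun y => g.inner y ((s y).1 v) ((s y).1 w)) =ᶠ[nhds x]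
        fun _ => modelInner ε v w := by
      filter_upwards [hs.isOpen.mem_nhds hx] with y hy
      exact σ.orthonormal (hs.mem y hy) v w
    rw [h2.mfderiv_eq, mfderiv_const] at h1
    rw [eq_neg_iff_add_eq_zero, hfr.symm _ ((s x).1 v)]
    exact h1.symm
  have hcomm := hfr.sum_commutator (σ.gamma_mul_add_swap x)
    (w := fun a => nabla (fun y => (s y).1 (Pi.single a 1)) x Z) (X := (s x).1 v)
    (Y := nabla (fun y => (s y).1 v) x Z) (fun a b => hskew _ _) (fun b => hskew _ _)
  have hcomm' := congrArg (fun L : Module.End 𝕜 (S x) => L ((s x).2 ψ)) hcomm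
  simp only [Φ]
  rw [hgeq, hnablaS U s hs x hx Z, hnablaS U s hs x hx Z, ← hcomm',
    ← σ.gamma_apply (hs.mem x hx)]
  simp only [LinearMap.smul_apply, LinearMap.sum_apply, LinearMap.sub_apply,
    Module.End.mul_apply, gammaLM_apply, hsmul, map_sum, smul_sub, Finset.sum_sub_distrib,
    metric_apply]
  abel

end SpinStructure

/-! ### Arithmetic of the signs $\Delta_k$ -/

section Signs

theorem neg_one_zpow_add_two_mul (k m : ℤ) : (-1 : ℤˣ) ^ (k + 2 * m) = (-1) ^ k := by
  rw [zpow_add, zpow_mul]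
  simp

/-- Replacing $k$ by $k+4q$ changes $k(k-1)/2$ by an even number. Statements about $\Delta_k$ thus
reduce to four residues and two signs. -/
theorem Delta_add_four_mul (d₀ d₁ : ℤˣ) (k q : ℤ) : Delta d₀ d₁ (k + 4 * q) = Delta d₀ d₁ k := by
  have h1 : (k + 4 * q) * (k + 4 * q - 1) / 2 =
      k * (k - 1) / 2 + 2 * (2 * k * q + 4 * q ^ 2 - q) := by
    rw [← Int.add_mul_ediv_left _ _ (by norm_num : (2 : ℤ) ≠ 0)]
    congr 1
    ring
  have h2 : ∀ d : ℤˣ, d ^ (4 * q) = 1 := by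
    intro d
    rcases Int.units_eq_one_or d with rfl | rfl
    · exact one_zpow _
    · rw [show 4 * q = 0 + 2 * (2 * q) by ring, neg_one_zpow_add_two_mul, zpow_zero]
  rw [Delta, Delta, h1, neg_one_zpow_add_two_mul, add_right_comm, zpow_add, zpow_add d₁, h2, h2,
    mul_one, mul_one]

/-- Write an integer as `r + 4 q` with `0 ≤ r < 4`. -/
theorem exists_eq_add_four_mul (k : ℤ) :
    ∃ q, k = 0 + 4 * q ∨ k = 1 + 4 * q ∨ k = 2 + 4 * q ∨ k = 3 + 4 * q :=
  ⟨k / 4, by omega⟩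

theorem Delta_zero (d₀ d₁ : ℤˣ) : Delta d₀ d₁ 0 = d₀ := by simp [Delta]

theorem Delta_one (d₀ d₁ : ℤˣ) : Delta d₀ d₁ 1 = d₁ := by
  rcases Int.units_eq_one_or d₀ with h | h <;> simp [Delta, h]

theorem Delta_two (d₀ d₁ : ℤˣ) : Delta d₀ d₁ 2 = -d₀ := by
  rcases Int.units_eq_one_or d₀ with rfl | rfl <;>
    rcases Int.units_eq_one_or d₁ with rfl | rfl <;> decide

theorem Delta_three (d₀ d₁ : ℤˣ) : Delta d₀ d₁ 3 = -d₁ := by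
  rcases Int.units_eq_one_or d₀ with rfl | rfl <;>
    rcases Int.units_eq_one_or d₁ with rfl | rfl <;> decide

theorem Delta_add_neg_one (d₀ d₁ : ℤˣ) (q : ℤ) : Delta d₀ d₁ (0 + 4 * q - 1) = -d₁ := by
  rw [show 0 + 4 * q - 1 = 3 + 4 * (q - 1) by ring, Delta_add_four_mul, Delta_three]

theorem Delta_one_mul_eq_neg_one_iff (d₀ d₁ : ℤˣ) (k : ℤ) :
    Delta d₀ d₁ 1 * Delta d₀ d₁ k = -1 ↔
      Delta d₀ d₁ 0 * Delta d₀ d₁ (k - 1) = (-1) ^ k := by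
  obtain ⟨q, rfl | rfl | rfl | rfl⟩ := exists_eq_add_four_mul k
  · rw [Delta_add_neg_one, Delta_add_four_mul, show 0 + 4 * q = 0 + 2 * (2 * q) by ring,
      neg_one_zpow_add_two_mul, Delta_zero, Delta_one]
    rcases Int.units_eq_one_or d₀ with rfl | rfl <;>
      rcases Int.units_eq_one_or d₁ with rfl | rfl <;> decide
  · rw [show 1 + 4 * q - 1 = 0 + 4 * q by ring, Delta_add_four_mul, Delta_add_four_mul,
      show 1 + 4 * q = 1 + 2 * (2 * q) by ring, neg_one_zpow_add_two_mul, Delta_zero, Delta_one]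
    rcases Int.units_eq_one_or d₀ with rfl | rfl <;>
      rcases Int.units_eq_one_or d₁ with rfl | rfl <;> decide
  · rw [show 2 + 4 * q - 1 = 1 + 4 * q by ring, Delta_add_four_mul, Delta_add_four_mul,
      show 2 + 4 * q = 2 + 2 * (2 * q) by ring, neg_one_zpow_add_two_mul, Delta_zero, Delta_one,
      Delta_two]
    rcases Int.units_eq_one_or d₀ with rfl | rfl <;>
      rcases Int.units_eq_one_or d₁ with rfl | rfl <;> decide
  · rw [show 3 + 4 * q - 1 = 2 + 4 * q by ring, Delta_add_four_mul, Delta_add_four_mul,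
      show 3 + 4 * q = 3 + 2 * (2 * q) by ring, neg_one_zpow_add_two_mul, Delta_zero, Delta_one,
      Delta_two, Delta_three]
    rcases Int.units_eq_one_or d₀ with rfl | rfl <;>
      rcases Int.units_eq_one_or d₁ with rfl | rfl <;> decide

/-- The triangular number changes by the odd number $2k-3$, while the other exponents keep their
parity. -/
theorem Delta_sub_two (d₀ d₁ : ℤˣ) (k : ℤ) : Delta d₀ d₁ (k - 2) = -Delta d₀ d₁ k := by
  have h1 : k * (k - 1) / 2 = (k - 2) * (k - 2 - 1) / 2 + (2 * k - 3) := by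
    rw [← Int.add_mul_ediv_left _ _ (by norm_num : (2 : ℤ) ≠ 0)]
    congr 1
    ring
  have h2 : ∀ (d : ℤˣ) (j : ℤ), d ^ (j - 2) = d ^ j := by
    intro d j
    rw [zpow_sub, show d ^ (2 : ℤ) = 1 from Int.units_sq d, inv_one, mul_one]
  rw [Delta, Delta, h1, show 2 * k - 3 = 1 + 2 * (k - 2) by ring, zpow_add _ _ (1 + _),
    neg_one_zpow_add_two_mul, sub_add_eq_add_sub, h2, h2]
  simp

/-- The equivalence one degree lower: the sign in $\Delta_{k-2}=-\Delta_k$ cancels the one in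
$(-1)^{k-1}=-(-1)^k$. It handles $G$, whose degree is one below that of $\mathcal A$. -/
theorem Delta_one_mul_sub_one_eq_neg_one_iff (d₀ d₁ : ℤˣ) (k : ℤ) :
    Delta d₀ d₁ 1 * Delta d₀ d₁ (k - 1) = -1 ↔
      Delta d₀ d₁ 0 * Delta d₀ d₁ k = (-1) ^ k := by
  rw [Delta_one_mul_eq_neg_one_iff, show k - 1 - 1 = k - 2 by ring, Delta_sub_two, zpow_sub_one,
    mul_neg, inv_neg, inv_one, mul_neg, mul_one, neg_inj]

theorem Delta_one_mul_eq_neg_one_iff_modEq (d₀ d₁ : ℤˣ) (k : ℤ) :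
    Delta d₀ d₁ 1 * Delta d₀ d₁ k = -1 ↔
      k ≡ 3 [ZMOD 4] ∨ k ≡ 1 + ((Delta d₀ d₁ 0 * Delta d₀ d₁ 1 : ℤˣ) : ℤ) [ZMOD 4] := by
  obtain ⟨q, rfl | rfl | rfl | rfl⟩ := exists_eq_add_four_mul k <;>
    rw [Delta_add_four_mul, Int.modEq_iff_dvd, Int.modEq_iff_dvd] <;>
    simp only [Delta_zero, Delta_one, Delta_two, Delta_three] <;>
    rcases Int.units_eq_one_or d₀ with rfl | rfl <;>
    rcases Int.units_eq_one_or d₁ with rfl | rfl <;> simp <;> omega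

theorem sgn_mul (s t : ℤˣ) : sgn (s * t) = sgn s * sgn t := by simp [sgn]

theorem sgn_pow (s : ℤˣ) (k : ℕ) : sgn (s ^ k) = sgn s ^ k := by simp [sgn]

theorem sgn_injective : Function.Injective sgn := fun s t h => by
  simpa [sgn, Units.ext_iff] using h

theorem sgn_eq_one_or (s : ℤˣ) : sgn s = 1 ∨ sgn s = -1 := by
  rcases Int.units_eq_one_or s with h | h <;> simp [h, sgn]

/-- The charge adjoint acts on `ℓ`-forms by the sign `Δ₀ Δ_ℓ`. -/
theorem adjointSign_sgn (d₀ d₁ : ℤˣ) (ℓ : ℕ) :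
    adjointSign (sgn (d₀ * d₁)) ℓ = sgn (d₀ * Delta d₀ d₁ ℓ) := by
  have h1 : ((ℓ : ℤ) * ((ℓ : ℤ) - 1) / 2) = ((ℓ * (ℓ - 1) / 2 : ℕ) : ℤ) := by
    cases ℓ with
    | zero => simp
    | succ ℓ => push_cast; simp
  have h2 : d₀ * Delta d₀ d₁ ℓ = (d₀ * d₁) ^ ℓ * (-1) ^ (ℓ * (ℓ - 1) / 2) := by
    rw [Delta, h1, zpow_natCast, zpow_natCast, zpow_add_one, zpow_natCast, mul_pow]
    have h3 : d₀ * d₀ = 1 := Int.units_mul_self d₀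
    calc _ = d₀ * d₀ * (d₀ ^ ℓ * d₁ ^ ℓ * (-1) ^ (ℓ * (ℓ - 1) / 2)) := by ac_rfl
      _ = _ := by rw [h3, one_mul]
  rw [h2, sgn_mul _ ((-1) ^ _), sgn_pow, sgn_pow, adjointSign]
  simp [sgn]

theorem adjointSign_eq_neg_iff (d₀ d₁ : ℤˣ) (ℓ : ℕ) :
    adjointSign (sgn (d₀ * d₁)) ℓ = -(-1) ^ ℓ ↔
      Delta d₀ d₁ 1 * Delta d₀ d₁ ((ℓ : ℤ) + 1) = -1 := by
  have h1 : -(-1 : ℝ) ^ ℓ = sgn ((-1) ^ ((ℓ : ℤ) + 1)) := by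
    rw [zpow_add_one, zpow_natCast, sgn_mul, sgn_pow]
    simp [sgn]
  rw [Delta_one_mul_eq_neg_one_iff, adjointSign_sgn, h1, sgn_injective.eq_iff, Delta_zero,
    add_sub_cancel_right]

theorem adjointSign_eq_iff (d₀ d₁ : ℤˣ) (ℓ : ℕ) :
    adjointSign (sgn (d₀ * d₁)) ℓ = (-1) ^ ℓ ↔
      Delta d₀ d₁ 1 * Delta d₀ d₁ ((ℓ : ℤ) - 1) = -1 := by
  have h1 : (-1 : ℝ) ^ ℓ = sgn ((-1) ^ (ℓ : ℤ)) := by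
    rw [zpow_natCast, sgn_pow]
    simp [sgn]
  rw [Delta_one_mul_sub_one_eq_neg_one_iff, adjointSign_sgn, h1, sgn_injective.eq_iff, Delta_zero]

end Signs

/-! ### Global decomposition and admissibility -/

namespace SpinStructure

variable {𝕜 : Type*} [RCLike 𝕜]
  {E : Type*} [NormedAddCommGroup E] [NormedSpace ℝ E]
  {M : Type*} [TopologicalSpace M] [ChartedSpace E M] [IsManifold 𝓘(ℝ, E) ∞ M]
  {F : Type*} [NormedAddCommGroup F] [NormedSpace ℝ F] [NormedSpace 𝕜 F] [IsScalarTower ℝ 𝕜 F]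
  [FiniteDimensional 𝕜 F]
  {n : ℕ} {ε : Fin n → ℤˣ}
  {S : M → Type*} [TopologicalSpace (Bundle.TotalSpace F S)]
  [∀ x, AddCommGroup (S x)] [∀ x, Module ℝ (S x)] [∀ x, Module 𝕜 (S x)]
  [∀ x, IsScalarTower ℝ 𝕜 (S x)] [∀ x, TopologicalSpace (S x)] [FiberBundle F S]
  {g : PseudoRiemannianMetric E M} {ρ : SpinorModule 𝕜 F ε}
  (σ : SpinStructure (𝕜 := 𝕜) S g ρ)
  {A : Π x : M, TangentSpace 𝓘(ℝ, E) x →ₗ[ℝ] S x →ₗ[𝕜] S x} {ℓ : ℕ}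

theorem ofForm_injective (x : M) {v w : TangentSpace 𝓘(ℝ, E) x [⋀^Fin ℓ]→ₗ[ℝ] 𝕜}
    (h : σ.ofForm x v = σ.ofForm x w) : v = w := by
  have := σ.nontrivial_fiber x
  rw [ofForm_eq, ofForm_eq, ← sub_eq_zero, ← map_sub] at h
  exact sub_eq_zero.1 (cliffordLM_injective (σ.isOrthonormalFrame_e x) (σ.gamma_mul_add_swap x)
    ℓ _ h)

/-- A homogeneous `𝒜` comes from a one-form with values in `ℓ`-forms. -/
theorem IsHomogeneous.exists_linearMap {σ : SpinStructure (𝕜 := 𝕜) S g ρ}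
    (hhom : σ.IsHomogeneous A ℓ) (x : M) :
    ∃ α : TangentSpace 𝓘(ℝ, E) x →ₗ[ℝ] TangentSpace 𝓘(ℝ, E) x [⋀^Fin ℓ]→ₗ[ℝ] 𝕜,
      ∀ X, A x X = σ.ofForm x (α X) := by
  -- Arbitrarily chosen representatives are automatically linear, since an `ℓ`-form is determined by
  -- its action.
  choose w hw using hhom x
  refine ⟨{ toFun := w, map_add' := fun X Y => ?_, map_smul' := fun r X => ?_ }, hw⟩
  · refine σ.ofForm_injective x ?_
    rw [← hw, map_add, hw, hw]
    exact (map_add (cliffordLM ε (σ.e x) (σ.gammaLM x) ℓ) _ _).symm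
  · refine σ.ofForm_injective x ?_
    rw [← hw, map_smul, hw]
    exact (map_smul (cliffordLM ε (σ.e x) (σ.gammaLM x) ℓ) _ _).symm

theorem isDecomposition_iff
    {Fform : Π x : M, TangentSpace 𝓘(ℝ, E) x [⋀^Fin (ℓ + 1)]→ₗ[ℝ] 𝕜}
    {Gform : Π x : M, TangentSpace 𝓘(ℝ, E) x [⋀^Fin (ℓ - 1)]→ₗ[ℝ] 𝕜}
    {A₀ : Π x : M, TangentSpace 𝓘(ℝ, E) x →ₗ[ℝ] TangentSpace 𝓘(ℝ, E) x [⋀^Fin ℓ]→ₗ[ℝ] 𝕜}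
    {α : Π x : M, TangentSpace 𝓘(ℝ, E) x →ₗ[ℝ] TangentSpace 𝓘(ℝ, E) x [⋀^Fin ℓ]→ₗ[ℝ] 𝕜}
    (hα : ∀ x X, A x X = σ.ofForm x (α x X)) :
    σ.IsDecomposition A ℓ Fform Gform A₀ ↔ ∀ x, (ℓ = 0 → Gform x = 0) ∧
      AlternatingMap.alternatizeUncurryFin (A₀ x) = 0 ∧ formTrace ε (σ.e x) ℓ (A₀ x) = 0 ∧
        α x = (Fform x).curryLeft + wedgeMap (metric g x) ℓ (Gform x) + A₀ x := by
  constructor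
  · intro h x
    refine ⟨fun h0 => congrFun (h.lower_eq_zero h0) x, h.alternation_eq_zero x,
      h.trace_eq_zero x, ?_⟩
    ext1 X
    refine σ.ofForm_injective x ?_
    rw [← hα, h.eq]
    simp [wedgeMap_apply]
  · intro h
    refine ⟨fun h0 => funext fun x => (h x).1 h0, fun x => (h x).2.1, fun x => (h x).2.2.1,
      fun x X => ?_⟩
    rw [hα, (h x).2.2.2]
    simp [wedgeMap_apply]

/-- The decomposition exists and is unique. -/
theorem existsUnique_decomposition (hℓ : ℓ ≤ n) (hhom : σ.IsHomogeneous A ℓ) :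
    ∃! FGA : (Π x : M, TangentSpace 𝓘(ℝ, E) x [⋀^Fin (ℓ + 1)]→ₗ[ℝ] 𝕜) ×
        (Π x : M, TangentSpace 𝓘(ℝ, E) x [⋀^Fin (ℓ - 1)]→ₗ[ℝ] 𝕜) ×
        (Π x : M, TangentSpace 𝓘(ℝ, E) x →ₗ[ℝ] TangentSpace 𝓘(ℝ, E) x [⋀^Fin ℓ]→ₗ[ℝ] 𝕜),
      σ.IsDecomposition A ℓ FGA.1 FGA.2.1 FGA.2.2 := by
  choose α hα using fun x => hhom.exists_linearMap x
  choose F G A₀ h0 h1 h2 h3 using fun x =>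
    (σ.isOrthonormalFrame_e x).exists_decomposition (𝕜 := 𝕜) hℓ (α x)
  refine ⟨(F, G, A₀), (σ.isDecomposition_iff hα).2 fun x => ⟨h0 x, h1 x, h2 x, h3 x⟩, ?_⟩
  rintro ⟨F', G', A₀'⟩ h
  have h' := (σ.isDecomposition_iff hα).1 h
  have huniq := fun x => (σ.isOrthonormalFrame_e x).decomposition_unique hℓ (h' x).1 (h0 x)
    (h' x).2.1 (h1 x) (h' x).2.2.1 (h2 x) ((h' x).2.2.2.symm.trans (h3 x))
  exact Prod.ext (funext fun x => (huniq x).1)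
    (Prod.ext (funext fun x => (huniq x).2.1) (funext fun x => (huniq x).2.2))

variable [FiniteDimensional ℝ E] [VectorBundle ℝ F S] [ContMDiffVectorBundle ∞ F S 𝓘(ℝ, E)]
  [∀ x, IsTopologicalAddGroup (S x)] [∀ x, ContinuousSMul ℝ (S x)]
  {C : ChargeConjugation ρ}
  {nabla : CovariantDerivative 𝓘(ℝ, E) E (TangentSpace 𝓘(ℝ, E) : M → Type _)}
  {nablaS D : CovariantDerivative 𝓘(ℝ, E) F S}

/-- Parallelism of $\gamma$ removes the derivatives. The minus sign in $D^C=\nabla-\mathcal A^C$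
becomes a plus in front of the adjoint term. -/
theorem hatDGamma_eq (hnabla : IsLeviCivita g nabla) (hnablaS : σ.IsSpinLeviCivita nabla nablaS)
    (hA : IsDifference D nablaS A) {x : M} {Z X : Π y : M, TangentSpace 𝓘(ℝ, E) y}
    {ξ : Π y : M, S y} (hX : MDiffAt (T% X) x) (hξ : MDiffAt (T% ξ) x) :
    σ.hatDGamma C nabla nablaS D A Z X ξ x =
      A x (Z x) (σ.gamma x (X x) (ξ x)) +
        σ.gamma x (X x) (σ.adjoint C x (A x (Z x)) (ξ x)) := by
  have h1 := hA x (fun y => σ.gamma y (X y) (ξ y)) (Z x) (σ.mdifferentiableAt_gamma hX hξ)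
  have h2 := σ.nabla_gamma hnabla hnablaS hX hξ (Z x)
  rw [hatDGamma, conjConnection, ← sub_add_cancel (D _ x (Z x)) (nablaS _ x (Z x)), ← h1, h2,
    map_sub]
  abel

/-- A bilinear map is skew exactly when it vanishes on the diagonal. -/
theorem isAdmissible_iff (hnabla : IsLeviCivita g nabla)
    (hnablaS : σ.IsSpinLeviCivita nabla nablaS) (hA : IsDifference D nablaS A)
    {α : Π x : M, TangentSpace 𝓘(ℝ, E) x →ₗ[ℝ] TangentSpace 𝓘(ℝ, E) x [⋀^Fin ℓ]→ₗ[ℝ] 𝕜}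
    (hα : ∀ x X, A x X = σ.ofForm x (α x X)) :
    σ.IsAdmissible C nabla nablaS D A ↔
      ∀ x Z, cliffordLM ε (σ.e x) (σ.gammaLM x) ℓ (α x Z) * σ.gammaLM x Z +
        adjointSign (sgn (C.Δ₀ * C.Δ₁)) ℓ •
          (σ.gammaLM x Z * cliffordLM ε (σ.e x) (σ.gammaLM x) ℓ (α x Z)) = 0 := by
  set τ := adjointSign (sgn (C.Δ₀ * C.Δ₁)) ℓ
  let m : Π x, TangentSpace 𝓘(ℝ, E) x → TangentSpace 𝓘(ℝ, E) x → Module.End 𝕜 (S x) :=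
    fun x Z X => cliffordLM ε (σ.e x) (σ.gammaLM x) ℓ (α x Z) * σ.gammaLM x X +
        τ • (σ.gammaLM x X * cliffordLM ε (σ.e x) (σ.gammaLM x) ℓ (α x Z))
  have hhat : ∀ {x : M} {Z X : Π y : M, TangentSpace 𝓘(ℝ, E) y} {ξ : Π y : M, S y},
      MDiffAt (T% X) x → MDiffAt (T% ξ) x →
        σ.hatDGamma C nabla nablaS D A Z X ξ x = m x (Z x) (X x) (ξ x) := by
    intro x Z X ξ hX hξ
    rw [σ.hatDGamma_eq hnabla hnablaS hA hX hξ, hα, σ.adjoint_ofForm, LinearMap.smul_apply,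
      ← algebraMap_smul 𝕜 (adjointSign _ _) (σ.ofForm _ _ _), map_smul, algebraMap_smul]
    rfl
  constructor
  · intro h x Z
    -- Spin frames provide differentiable sections with prescribed values at `x`, on which
    -- admissibility is tested with both vector fields equal.
    obtain ⟨U, s, hx, hs⟩ := σ.exists_isSpinFrame x
    ext ξ
    obtain ⟨v, rfl⟩ := (s x).1.surjective Z
    obtain ⟨ψ, rfl⟩ := (s x).2.surjective ξ
    have h1 := hs.mdifferentiableAt_fst hx v
    have h2 := hs.mdifferentiableAt_snd hx ψ
    have h3 := h x _ _ _ h1 h1 h2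
    rw [hhat h1 h2, eq_neg_iff_add_eq_zero, ← two_smul ℝ] at h3
    exact (smul_eq_zero.1 h3).resolve_left two_ne_zero
  · intro h x Z X ξ hZ hX hξ
    rw [hhat hX hξ, hhat hZ hξ, eq_neg_iff_add_eq_zero, ← LinearMap.add_apply]
    have h1 : m x (Z x) (X x) + m x (X x) (Z x) = 0 := by
      have h2 : m x (Z x + X x) (Z x + X x) =
          m x (Z x) (Z x) + (m x (Z x) (X x) + m x (X x) (Z x)) + m x (X x) (X x) := by
        simp only [m, map_add, mul_add, add_mul, smul_add]
        abel
      have h3 : ∀ Y, m x Y Y = 0 := h x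
      rw [h3, h3, h3, zero_add, add_zero] at h2
      exact h2.symm
    rw [h1, LinearMap.zero_apply]

end SpinStructure

end

end SpinGeometry

theorem theorem4p4 {𝕜 : Type*} [RCLike 𝕜]
    {E : Type*} [NormedAddCommGroup E] [NormedSpace ℝ E] [FiniteDimensional ℝ E]
    {M : Type*} [TopologicalSpace M] [ChartedSpace E M] [IsManifold 𝓘(ℝ, E) ∞ M]
    {F : Type*} [NormedAddCommGroup F] [NormedSpace ℝ F] [NormedSpace 𝕜 F] [IsScalarTower ℝ 𝕜 F]
    [FiniteDimensional 𝕜 F]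
    {S : M → Type*} [TopologicalSpace (Bundle.TotalSpace F S)]
    [∀ x, AddCommGroup (S x)] [∀ x, Module ℝ (S x)] [∀ x, Module 𝕜 (S x)]
    [∀ x, IsScalarTower ℝ 𝕜 (S x)] [∀ x, TopologicalSpace (S x)]
    [∀ x, IsTopologicalAddGroup (S x)] [∀ x, ContinuousSMul ℝ (S x)]
    [FiberBundle F S] [VectorBundle ℝ F S] [ContMDiffVectorBundle ∞ F S 𝓘(ℝ, E)]
    {n : ℕ} {ε : Fin n → ℤˣ}
    (g : SpinGeometry.PseudoRiemannianMetric E M)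
    (ρ : SpinGeometry.SpinorModule 𝕜 F ε) (C : SpinGeometry.ChargeConjugation ρ)
    (σ : SpinGeometry.SpinStructure (𝕜 := 𝕜) S g ρ)
    (nabla : CovariantDerivative 𝓘(ℝ, E) E (TangentSpace 𝓘(ℝ, E) : M → Type _))
    (hnabla : SpinGeometry.IsLeviCivita g nabla)
    (nablaS : CovariantDerivative 𝓘(ℝ, E) F S) (hnablaS : σ.IsSpinLeviCivita nabla nablaS)
    (D : CovariantDerivative 𝓘(ℝ, E) F S)
    (A : Π x : M, TangentSpace 𝓘(ℝ, E) x →ₗ[ℝ] S x →ₗ[𝕜] S x)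
    (hA : SpinGeometry.SpinStructure.IsDifference D nablaS A)
    (ℓ : ℕ) (hℓ : ℓ ≤ n) (hhom : σ.IsHomogeneous A ℓ) :
    -- the decomposition exists and is unique
    (∃! FGA : (Π x : M, TangentSpace 𝓘(ℝ, E) x [⋀^Fin (ℓ + 1)]→ₗ[ℝ] 𝕜) ×
        (Π x : M, TangentSpace 𝓘(ℝ, E) x [⋀^Fin (ℓ - 1)]→ₗ[ℝ] 𝕜) ×
        (Π x : M, TangentSpace 𝓘(ℝ, E) x →ₗ[ℝ] TangentSpace 𝓘(ℝ, E) x [⋀^Fin ℓ]→ₗ[ℝ] 𝕜),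
      σ.IsDecomposition A ℓ FGA.1 FGA.2.1 FGA.2.2) ∧
    -- the characterization of admissibility
    (∀ (Fform : Π x : M, TangentSpace 𝓘(ℝ, E) x [⋀^Fin (ℓ + 1)]→ₗ[ℝ] 𝕜)
        (Gform : Π x : M, TangentSpace 𝓘(ℝ, E) x [⋀^Fin (ℓ - 1)]→ₗ[ℝ] 𝕜)
        (A₀ : Π x : M, TangentSpace 𝓘(ℝ, E) x →ₗ[ℝ] TangentSpace 𝓘(ℝ, E) x [⋀^Fin ℓ]→ₗ[ℝ] 𝕜),
      σ.IsDecomposition A ℓ Fform Gform A₀ →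
      (σ.IsAdmissible C nabla nablaS D A ↔
        A₀ = 0 ∧ (Fform ≠ 0 → C.Δ 1 * C.Δ ((ℓ : ℤ) + 1) = -1) ∧
          (Gform ≠ 0 → C.Δ 1 * C.Δ ((ℓ : ℤ) - 1) = -1))) ∧
    -- the equivalent forms of the condition on the degree
    (∀ deg : ℤ,
      (C.Δ 1 * C.Δ deg = -1 ↔ C.Δ 0 * C.Δ (deg - 1) = (-1) ^ deg) ∧
      (C.Δ 1 * C.Δ deg = -1 ↔
        deg ≡ 3 [ZMOD 4] ∨ deg ≡ 1 + ((C.Δ 0 * C.Δ 1 : ℤˣ) : ℤ) [ZMOD 4])) := by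
  refine ⟨σ.existsUnique_decomposition hℓ hhom, ?_, fun deg =>
    ⟨SpinGeometry.Delta_one_mul_eq_neg_one_iff _ _ _,
      by simpa only [SpinGeometry.ChargeConjugation.Δ] using
        SpinGeometry.Delta_one_mul_eq_neg_one_iff_modEq C.Δ₀ C.Δ₁ deg⟩⟩
  intro Fform Gform A₀ hdec
  choose α hα using fun x => hhom.exists_linearMap x
  have hdec' := (σ.isDecomposition_iff hα).1 hdec
  rw [σ.isAdmissible_iff hnabla hnablaS hA hα]
  have hτ : SpinGeometry.adjointSign (SpinGeometry.sgn (C.Δ₀ * C.Δ₁)) ℓ = 1 ∨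
      SpinGeometry.adjointSign (SpinGeometry.sgn (C.Δ₀ * C.Δ₁)) ℓ = -1 := by
    rw [SpinGeometry.adjointSign_sgn]
    exact SpinGeometry.sgn_eq_one_or _
  have hpt : ∀ x, _ := fun x => by
    have := σ.nontrivial_fiber x
    exact (σ.isOrthonormalFrame_e x).anticommute_iff (σ.gamma_mul_add_swap x) hℓ (hdec' x).1
      (hdec' x).2.1 (hdec' x).2.2.1 (hdec' x).2.2.2 hτ
  -- The sign conditions do not depend on the point and a form is nonzero if it is so somewhere, so
  -- the pointwise criteria assemble into the global one.
  rw [forall_congr' hpt, SpinGeometry.adjointSign_eq_neg_iff, SpinGeometry.adjointSign_eq_iff,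
    Function.ne_iff, Function.ne_iff, funext_iff, forall_and, forall_and]
  simp only [forall_exists_index]
  rfl
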